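/- **Setting.** Let $\mathsf{Time}$ be $[0,\infty)$ or $\mathbb N_0$. A *TC-space* is a filtered standard Borel space $(\Omega,\mathcal F,(\mathcal F_t))$, $\mathcal F=\bigvee_t\mathcal F_t$, with * a jointly measurable family of truncations $T_t:\Omega\to\Omega$, $\omega_{\le t}=T_t(\omega)$, such that $T_t\circ T_s=T_{s\wedge t}$ and $\mathcal F_t=\sigma(T_t)$; * a measurable compatibility set $\mathcal C\subseteq\Omega\times\mathsf{Time}\times\Omega$ and a measurable concatenation $\ast:\mathcal C\to\Omega$ such that, for all $s,t$, $(\omega,t,\omega')\in\mathcal C\Leftrightarrow(\omega_{\le t},t,\omega')\in\mathcal C\Leftrightarrow(\omega,t,\omega'_{\le s})\in\mathcal C$, and for $(\omega,t,\omega')\in\mathcal C$: $\omega\ast_t\omega'=\omega_{\le t}\ast_t\omega'$, $(\omega\ast_t\omega')_{\le s}=\omega_{\le s}$ if $s\le t$, and $(\omega\ast_t\omega')_{\le s}=\omega\ast_t\omega'_{\le s-t}$ if $s>t$. Put $T_\infty=\mathrm{id}$, $\mathcal C_{\omega,t}=\{\omega':(\omega,t,\omega')\in\mathcal C\}$, $\mathcal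 C_{\omega,\infty}=\Omega$, $\omega\ast_\infty\omega'=\omega$. Stopping times are those of the raw filtration $(\mathcal F_t)$ and may take the value $\infty$. Let $D^0_{\mathbb R}$ be the space of real càdlàg paths $x$ on $\mathsf{Time}$ with $x(0)=0$, with the $\sigma$-algebra generated by the coordinates, the truncation $T_t(x)(s)=x(s\wedge t)$, and the adjusted concatenation $(x\star_t y)(s)=x(s)$ for $s\le t$, $(x\star_t y)(s)=x(t)+y(s-t)-y(0)$ for $s>t$ (all pairs compatible). A measurable map $F:\Omega\to D^0_{\mathbb R}$ is a *TC-morphism* if $F^{-1}(\sigma(T_t))\subseteq\mathcal F_t$ for all $t$ and $F(\omega\ast_t\omega')=F(\omega)\star_tF(\omega')$ whenever $(\omega,t,\omega')\in\mathcal C$. For $n\ge1$ let $\tau_n(\omega)=\inf\{t\ge0:|F_t(\omega)|\ge n\}\wedge n$ and $F^n_t=F_{\tau_n\wedge t}$. The map $F$ is *canonically locally bounded* if there are constants $M_n>0$ with $|F^n_t(\omega)|\le M_n$ for all $\omega,t$. A probability measure $\mu$ on $\Omega$ belongs to $\mathcal M^{F,loc}$ if for each $n\ge1$ the process $F^n$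 is a martingale under $\mu$ and $(\mathcal F_t)$, with measurability up to $\mu$-null sets: each $F^n_t$ is $\mu$-integrable and $\mathbb E^\mu[F^n_t\mid\mathcal F_s]=F^n_s$ $\mu$-a.s. for $s\le t$. Let $\mathcal D$ be a family of canonically locally bounded TC-morphisms from $\Omega$ into $(D^0_{\mathbb R},\star)$, and let $X:\Omega\to E$ be a state map, i.e. a measurable map into a Polish space; write $X_t=X\circ T_t$. The *$(\mathcal D,X)$-generated correspondence* is $$\mathcal P(\omega)=\Big\{\mu\in\mathsf{Prob}(\Omega):\ \mu\in\bigcap_{F\in\mathcal D}\mathcal M^{F,loc},\ X_0=X(\omega)\ \ \mu\text{-a.s.}\Big\}.$$ A *selector* is a universally measurable kernel $\nu$ from $\Omega$ to $\Omega$ with $\nu_\omega\in\mathcal P(\omega)$ for every $\omega$. For a stopping time $\tau$ put $\nu^{\le\tau}_\omega=\nu_{T_{\tau(\omega)}(\omega)}$; $\mu$ and $\nu$ are *compatible at $\tau$* if $\nu^{\le\tau}_\omega(\mathcal C_{\omega,\tau(\omega)})=1$ for $\mu$-a.e. $\omega$, and then $\mu\ast_\tau\nu$ is the push-forward of $\mu\otimes\nu^{\le\tau}$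 under $(\omega,\omega')\mapsto\omega\ast_{\tau(\omega)}\omega'$. **Proposition.** 1. For all $\omega\in\Omega$, $\mu\in\mathcal P(\omega)$, selectors $\nu$ of $\mathcal P$ and stopping times $\tau$ such that $\mu$ and $\nu$ are compatible at $\tau$, one has $\mu\ast_\tau\nu\in\mathcal P(\omega)$. 2. If, moreover, $\ast$ factors through $X$, i.e. $X_t(\omega)=X_0(\omega')$ implies $(\omega,t,\omega')\in\mathcal C$, then $\mathcal P$ is concatenable: for all $\omega\in\Omega$, $\mu\in\mathcal P(\omega)$, selectors $\nu$ of $\mathcal P$ and stopping times $\tau$, the measure $\mu$ and the kernel $\nu$ are compatible at $\tau$ and $\mu\ast_\tau\nu\in\mathcal P(\omega)$. -/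

import Mathlib

open MeasureTheory ProbabilityTheory Filter Topology
open scoped NNReal ENNReal

/-- The time set is either `[0, ∞)` or `ℕ₀`, each with its usual arithmetic, order, infima,
topology and Borel `σ`-algebra. -/
class inductive IsTimeSet : (𝕋 : Type) → [CommSemiring 𝕋] → [LinearOrder 𝕋] → [InfSet 𝕋] →
    [Sub 𝕋] → [TopologicalSpace 𝕋] → [MeasurableSpace 𝕋] → Prop
  | nnreal : IsTimeSet ℝ≥0
  | nat : IsTimeSet ℕ

attribute [instance] IsTimeSet.nnreal IsTimeSet.nat

/-! ### Truncation-concatenation spaces -/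

/-- The operations of a truncation-concatenation space: the truncations
`T_t ω = ω_{≤ t}`, the compatibility set `𝒞 ⊆ Ω × Time × Ω`, and the concatenation
`ω ∗_t ω'`. The concatenation is written as a total function, but it is meaningful only for
`(ω, t, ω') ∈ 𝒞`; its values elsewhere are irrelevant and no law constrains them. -/
structure TCOps (𝕋 Ω : Type*) where
  trunc : 𝕋 → Ω → Ω
  compat : Set (Ω × 𝕋 × Ω)
  concat : Ω → 𝕋 → Ω → Ω

namespace TCOps

variable {𝕋 Ω Ω' : Type*}

/-- Truncation at an extended time, with `T_∞ = id`. -/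
def truncTop (S : TCOps 𝕋 Ω) : WithTop 𝕋 → Ω → Ω
  | none => id
  | some t => S.trunc t

/-- `𝒞_{ω,t}`, the set of all `ω'` compatible with `ω` at `t`, with `𝒞_{ω,∞} = Ω`. -/
def compatTop (S : TCOps 𝕋 Ω) (ω : Ω) : WithTop 𝕋 → Set Ω
  | none => Set.univ
  | some t => {ω' | (ω, t, ω') ∈ S.compat}

/-- Concatenation at an extended time, with `ω ∗_∞ ω' = ω`. -/
def concatTop (S : TCOps 𝕋 Ω) (ω : Ω) : WithTop 𝕋 → Ω → Ω
  | none => fun _ => ω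
  | some t => S.concat ω t

/-- A measurable map `F : Ω → Ω'` is non-anticipating if `F⁻¹(σ(T'_t)) ⊆ σ(T_t)` for all `t`. -/
def IsNonAnticipating [mΩ : MeasurableSpace Ω] [mΩ' : MeasurableSpace Ω']
    (S : TCOps 𝕋 Ω) (S' : TCOps 𝕋 Ω') (F : Ω → Ω') : Prop :=
  Measurable F ∧ ∀ t : 𝕋, Measurable[mΩ.comap (S.trunc t), mΩ'.comap (S'.trunc t)] F

/-- Truncation-concatenation morphisms. -/
structure IsMorphism [MeasurableSpace Ω] [MeasurableSpace Ω']
    (S : TCOps 𝕋 Ω) (S' : TCOps 𝕋 Ω') (F : Ω → Ω') : Prop where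
  nonAnticipating : S.IsNonAnticipating S' F
  compat : ∀ ω t ω', (ω, t, ω') ∈ S.compat → (F ω, t, F ω') ∈ S'.compat
  map_concat : ∀ ω t ω', (ω, t, ω') ∈ S.compat →
    F (S.concat ω t ω') = S'.concat (F ω) t (F ω')

end TCOps

/-- A TC-space: a filtered standard Borel space with a truncation `T` that generates its
filtration, a measurable compatibility set and a measurable concatenation, subject to the
compatibility laws between truncation and concatenation. -/
structure TCSpace (𝕋 Ω : Type*) [AddCommMonoid 𝕋] [LinearOrder 𝕋] [Sub 𝕋] [MeasurableSpace 𝕋]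
    [mΩ : MeasurableSpace Ω] extends TCOps 𝕋 Ω where
  standardBorel : StandardBorelSpace Ω
  /-- the raw filtration `ℱ_t` -/
  filtration : Filtration 𝕋 mΩ
  iSup_filtration : ⨆ t, filtration t = mΩ
  measurable_trunc : Measurable fun p : 𝕋 × Ω => trunc p.1 p.2
  trunc_trunc : ∀ s t ω, trunc t (trunc s ω) = trunc (min s t) ω
  filtration_eq : ∀ t, filtration t = mΩ.comap (trunc t)
  measurableSet_compat : MeasurableSet compat
  measurable_concat : Measurable fun p : compat => concat p.1.1 p.1.2.1 p.1.2.2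
  compat_trunc_left : ∀ ω t ω', (ω, t, ω') ∈ compat ↔ (trunc t ω, t, ω') ∈ compat
  compat_trunc_right : ∀ ω t ω' s, (ω, t, ω') ∈ compat ↔ (ω, t, trunc s ω') ∈ compat
  concat_trunc_left : ∀ ω t ω', (ω, t, ω') ∈ compat →
    concat ω t ω' = concat (trunc t ω) t ω'
  trunc_concat_of_le : ∀ ω t ω' s, (ω, t, ω') ∈ compat → s ≤ t →
    trunc s (concat ω t ω') = trunc s ω
  trunc_concat_of_lt : ∀ ω t ω' s, (ω, t, ω') ∈ compat → t < s →
    trunc s (concat ω t ω') = concat ω t (trunc (s - t) ω')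

/-! ### The model space `(D_ℝ⁰, ⋆)` of real càdlàg paths started at zero -/

/-- Right-continuous functions with left limits. -/
def IsCadlag {𝕋 : Type*} [LinearOrder 𝕋] [TopologicalSpace 𝕋] (x : 𝕋 → ℝ) : Prop :=
  (∀ t, ContinuousWithinAt x (Set.Ici t) t) ∧ ∀ t, ∃ l, Tendsto x (𝓝[<] t) (𝓝 l)

theorem IsCadlag.stopped {𝕋 : Type} [CommSemiring 𝕋] [LinearOrder 𝕋] [InfSet 𝕋] [Sub 𝕋]
    [TopologicalSpace 𝕋] [MeasurableSpace 𝕋] [h𝕋 : IsTimeSet 𝕋] {x : 𝕋 → ℝ} (hx : IsCadlag x)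
    (t : 𝕋) : IsCadlag fun s => x (min s t) := by
  cases h𝕋 with
  | nat =>
    refine ⟨fun s => continuous_of_discreteTopology.continuousWithinAt, fun s => ?_⟩
    have : 𝓝[<] s = ⊥ := by simp [nhdsWithin, ← Filter.principal_singleton, inf_principal]
    exact ⟨0, by simp [this]⟩
  | nnreal =>
    refine ⟨fun s => ?_, fun s => ?_⟩
    · refine ContinuousWithinAt.comp (t := Set.Ici (min s t)) (hx.1 _) (by fun_prop) ?_
      intro r hr
      exact min_le_min_right t hr
    · by_cases hs : s ≤ t
      · obtain ⟨l, hl⟩ := hx.2 s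
        refine ⟨l, hl.congr' ?_⟩
        filter_upwards [self_mem_nhdsWithin] with r hr
        rw [min_eq_left ((le_of_lt hr).trans hs)]
      · refine ⟨x t, tendsto_const_nhds.congr' ?_⟩
        filter_upwards [mem_nhdsWithin_of_mem_nhds (Ioi_mem_nhds (not_le.1 hs))] with r hr
        rw [min_eq_right (le_of_lt hr)]

theorem IsCadlag.adjustedConcat {𝕋 : Type} [CommSemiring 𝕋] [LinearOrder 𝕋] [InfSet 𝕋] [Sub 𝕋]
    [TopologicalSpace 𝕋] [MeasurableSpace 𝕋] [h𝕋 : IsTimeSet 𝕋] {x y : 𝕋 → ℝ} (hx : IsCadlag x)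
    (hy : IsCadlag y) (t : 𝕋) :
    IsCadlag fun s => if s ≤ t then x s else x t + y (s - t) - y 0 := by
  cases h𝕋 with
  | nat =>
    refine ⟨fun s => continuous_of_discreteTopology.continuousWithinAt, fun s => ?_⟩
    have : 𝓝[<] s = ⊥ := by simp [nhdsWithin, ← Filter.principal_singleton, inf_principal]
    exact ⟨0, by simp [this]⟩
  | nnreal =>
    have key : ∀ s, t ≤ s → (if s ≤ t then x s else x t + y (s - t) - y 0)
        = x t + y (s - t) - y 0 := by
      intro s hs
      split_ifs with h
      · obtain rfl := le_antisymm h hs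
        simp
      · rfl
    refine ⟨fun s => ?_, fun s => ?_⟩
    · by_cases hs : s < t
      · refine (hx.1 s).congr_of_eventuallyEq ?_ (if_pos hs.le)
        filter_upwards [mem_nhdsWithin_of_mem_nhds (Iio_mem_nhds hs)] with r hr
        exact if_pos (le_of_lt hr)
      · have hts : t ≤ s := not_lt.1 hs
        have hc : ContinuousWithinAt (fun r => x t + y (r - t) - y 0) (Set.Ici s) s := by
          have h1 : ContinuousWithinAt (fun r : ℝ≥0 => y (r - t)) (Set.Ici s) s :=
            ContinuousWithinAt.comp (f := fun r : ℝ≥0 => r - t) (t := Set.Ici (s - t)) (hy.1 _)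
              (by fun_prop) fun r hr => tsub_le_tsub_right hr t
          exact (continuousWithinAt_const.add h1).sub continuousWithinAt_const
        exact hc.congr (fun r hr => key r (hts.trans hr)) (key s hts)
    · by_cases hs : s ≤ t
      · obtain ⟨l, hl⟩ := hx.2 s
        refine ⟨l, hl.congr' ?_⟩
        filter_upwards [self_mem_nhdsWithin] with r hr
        exact (if_pos ((le_of_lt hr).trans hs)).symm
      · have hts : t < s := not_le.1 hs
        obtain ⟨l, hl⟩ := hy.2 (s - t)
        have hg : Tendsto (fun r : ℝ≥0 => r - t) (𝓝[<] s) (𝓝[<] (s - t)) := by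
          refine tendsto_nhdsWithin_iff.2 ⟨?_, ?_⟩
          · exact ((continuous_id.sub continuous_const).tendsto s).mono_left nhdsWithin_le_nhds
          · filter_upwards [self_mem_nhdsWithin] with r hr
            rw [Set.mem_Iio, ← NNReal.coe_lt_coe, NNReal.coe_sub hts.le, NNReal.coe_sub_def]
            have h2 : (r : ℝ) < s := hr
            have h3 : (t : ℝ) < s := hts
            exact max_lt (by linarith) (by linarith)
        refine ⟨x t + l - y 0, (((hl.comp hg).const_add (x t)).sub_const (y 0)).congr' ?_⟩
        filter_upwards [mem_nhdsWithin_of_mem_nhds (Ioi_mem_nhds hts)] with r hr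
        exact (key r (le_of_lt hr)).symm

/-- `D_ℝ⁰`: real càdlàg paths `x` with `x(0) = 0`. -/
def CadlagZero (𝕋 : Type*) [Zero 𝕋] [LinearOrder 𝕋] [TopologicalSpace 𝕋] : Type _ :=
  {x : 𝕋 → ℝ // IsCadlag x ∧ x 0 = 0}

/-- The `σ`-algebra of `D_ℝ⁰` is generated by the coordinate maps (it is the Borel `σ`-algebra of
the Skorokhod topology). -/
instance {𝕋 : Type*} [Zero 𝕋] [LinearOrder 𝕋] [TopologicalSpace 𝕋] :
    MeasurableSpace (CadlagZero 𝕋) :=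
  inferInstanceAs (MeasurableSpace {x : 𝕋 → ℝ // IsCadlag x ∧ x 0 = 0})

/-- `(D_ℝ⁰, ⋆)`: the truncation stops a path, the adjusted concatenation attaches the increments
of the second path to the first one, and any two paths are compatible at any time. -/
noncomputable def cadlagZeroOps (𝕋 : Type) [CommSemiring 𝕋] [LinearOrder 𝕋] [InfSet 𝕋] [Sub 𝕋]
    [TopologicalSpace 𝕋] [MeasurableSpace 𝕋] [h𝕋 : IsTimeSet 𝕋] : TCOps 𝕋 (CadlagZero 𝕋) where
  trunc t x := ⟨fun s => x.1 (min s t), x.2.1.stopped t, by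
    have h0 : min (0 : 𝕋) t = 0 := by cases h𝕋 <;> simp
    simpa [h0] using x.2.2⟩
  compat := Set.univ
  concat x t y := ⟨fun s => if s ≤ t then x.1 s else x.1 t + y.1 (s - t) - y.1 0,
    x.2.1.adjustedConcat y.2.1 t, by
    have h0 : (0 : 𝕋) ≤ t := by cases h𝕋 <;> simp
    simpa [h0] using x.2.2⟩

/-! ### Canonical local martingales -/

section CanonicalLocalMartingale

variable {𝕋 : Type} [CommSemiring 𝕋] [LinearOrder 𝕋] [InfSet 𝕋]

/-- The space-time exit time `τ_n = inf {t ≥ 0 : |y_t| ≥ n} ∧ n` of a path `y`, written as the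
infimum of the nonempty set `{t : |y_t| ≥ n} ∪ {n}`. -/
def exitTime (n : ℕ) (y : 𝕋 → ℝ) : 𝕋 :=
  sInf ({t | (n : ℝ) ≤ |y t|} ∪ {(n : 𝕋)})

/-- The stopped path `y^n_t = y_{τ_n ∧ t}`. -/
def exitStopped (n : ℕ) (y : 𝕋 → ℝ) (t : 𝕋) : ℝ :=
  y (min (exitTime n y) t)

variable [TopologicalSpace 𝕋] {Ω : Type*} [mΩ : MeasurableSpace Ω]

/-- `μ` is a canonical local-martingale probability for `F`: for each `n = 1, 2, …`, the process
`F^n` is a martingale under `μ`. Since hitting times of càdlàg paths need not be measurable for the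
raw filtration, measurability of `F^n_t` is understood up to `μ`-null sets: `F^n_t` is integrable
and `F^n_s = 𝔼^μ[F^n_t | ℱ_s]` `μ`-a.s. for `s ≤ t` (for `s = t` this is adaptedness up to
`μ`-null sets). -/
def IsCanonicalLocalMartingale (𝓕 : Filtration 𝕋 mΩ) (F : Ω → CadlagZero 𝕋) (μ : Measure Ω) :
    Prop :=
  ∀ n : ℕ, 1 ≤ n →
    (∀ t, Integrable (fun ω => exitStopped n (F ω).1 t) μ) ∧
    ∀ s t, s ≤ t → μ[fun ω => exitStopped n (F ω).1 t | 𝓕 s] =ᵐ[μ]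
      fun ω => exitStopped n (F ω).1 s

/-- When the processes `F^n` are adapted to the raw filtration, the definition is the usual one. -/
theorem isCanonicalLocalMartingale_iff_martingale (𝓕 : Filtration 𝕋 mΩ) (F : Ω → CadlagZero 𝕋)
    (μ : Measure Ω) [IsProbabilityMeasure μ]
    (hF : ∀ n : ℕ, 1 ≤ n → StronglyAdapted 𝓕 fun t ω => exitStopped n (F ω).1 t) :
    IsCanonicalLocalMartingale 𝓕 F μ ↔
      ∀ n : ℕ, 1 ≤ n → Martingale (fun t ω => exitStopped n (F ω).1 t) 𝓕 μ :=
  ⟨fun h n hn => ⟨hF n hn, (h n hn).2⟩,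
    fun h n hn => ⟨fun t => (h n hn).integrable t, (h n hn).2⟩⟩

/-- `F` is canonically locally bounded if `|F^n| ≤ M_n` on `Ω × Time`, for constants `M_n > 0`. -/
def IsCanonicallyLocallyBounded (F : Ω → CadlagZero 𝕋) : Prop :=
  ∃ M : ℕ → ℝ, ∀ n : ℕ, 1 ≤ n → 0 < M n ∧ ∀ ω t, |exitStopped n (F ω).1 t| ≤ M n

end CanonicalLocalMartingale

/-- A kernel from `Ω` to `Ω`: a universally measurable family of probability measures. -/
def IsUniversalKernel {Ω : Type*} [MeasurableSpace Ω] (ν : Ω → Measure Ω) : Prop :=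
  (∀ ω, IsProbabilityMeasure (ν ω)) ∧
    ∀ B, MeasurableSet B → ∀ ρ : Measure Ω, IsProbabilityMeasure ρ →
      NullMeasurable (fun ω => ν ω B) ρ

/-- A selector of a correspondence `P` from `Ω` to the probability measures on `Ω`. -/
def IsSelector {Ω : Type*} [MeasurableSpace Ω] (P : Ω → Set (Measure Ω)) (ν : Ω → Measure Ω) :
    Prop :=
  IsUniversalKernel ν ∧ ∀ ω, ν ω ∈ P ω

namespace TCSpace

variable {𝕋 : Type} [CommSemiring 𝕋] [LinearOrder 𝕋] [InfSet 𝕋] [Sub 𝕋] [TopologicalSpace 𝕋]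
  [MeasurableSpace 𝕋] {Ω : Type*} [MeasurableSpace Ω] {E : Type*}

/-- The restricted kernel `ν^{≤ τ}_ω = ν_{T_τ(ω)}`. -/
def restrictedKernel (S : TCSpace 𝕋 Ω) (τ : Ω → WithTop 𝕋) (ν : Ω → Measure Ω) :
    Ω → Measure Ω :=
  fun ω => ν (S.truncTop (τ ω) ω)

/-- `μ` and `ν` are compatible at `τ`: `ν^{≤ τ}_ω(𝒞_{ω, τ(ω)}) = 1` for `μ`-almost all `ω`. -/
def MeasureCompatible (S : TCSpace 𝕋 Ω) (τ : Ω → WithTop 𝕋) (μ : Measure Ω) (ν : Ω → Measure Ω) :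
    Prop :=
  ∀ᵐ ω ∂μ, S.restrictedKernel τ ν ω (S.compatTop ω (τ ω)) = 1

/-- The concatenation `μ ∗_τ ν`: the push-forward of the product `μ ⊗ ν^{≤ τ}` on `Ω × Ω`
via `(ω, ω') ↦ ω ∗_{τ(ω)} ω'`. -/
noncomputable def measureConcat (S : TCSpace 𝕋 Ω) (τ : Ω → WithTop 𝕋) (μ : Measure Ω)
    (ν : Ω → Measure Ω) : Measure Ω :=
  (μ.bind fun ω => (S.restrictedKernel τ ν ω).map (Prod.mk ω)).map
    fun p => S.concatTop p.1 (τ p.1) p.2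

/-- A correspondence is concatenable if selectors are compatible with its measures at all stopping
times, and concatenation with them does not leave the correspondence. -/
def IsConcatenable (S : TCSpace 𝕋 Ω) (P : Ω → Set (Measure Ω)) : Prop :=
  ∀ ω, ∀ μ ∈ P ω, ∀ ν, IsSelector P ν → ∀ τ, IsStoppingTime S.filtration τ →
    S.MeasureCompatible τ μ ν ∧ S.measureConcat τ μ ν ∈ P ω

/-- The concatenation operator factors through the state map `X`: it is enough for compatibility
that `X_t(ω) = X_0(ω')`, where `X_t = X ∘ T_t`. -/
def FactorsThrough (S : TCSpace 𝕋 Ω) (X : Ω → E) : Prop :=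
  ∀ ω t ω', X (S.trunc t ω) = X (S.trunc 0 ω') → (ω, t, ω') ∈ S.compat

/-- The `(𝒟, X)`-generated correspondence `P(ω) = P̄(X(ω))`, where `P̄(x)` is the set of all
probability measures `μ` which are canonical local-martingale probabilities for each `F ∈ 𝒟` and
for which `X_0 = x`, `μ`-a.s. -/
def generatedCorrespondence (S : TCSpace 𝕋 Ω) (𝒟 : Set (Ω → CadlagZero 𝕋)) (X : Ω → E) (ω : Ω) :
    Set (Measure Ω) :=
  {μ | IsProbabilityMeasure μ ∧ (∀ F ∈ 𝒟, IsCanonicalLocalMartingale S.filtration F μ) ∧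
    ∀ᵐ ω' ∂μ, X (S.trunc 0 ω') = X ω}

end TCSpace

/-!
Both assertions reduce to the stability of canonical local martingales under concatenation. The
measure `μ ∗_τ ν` is the law of `ω ∗_τ ω'`, where `ω` has law `μ` and `ω'` has conditional law
`κ_ω = ν_{T_τ(ω)}`. A morphism `F` turns concatenation into the addition of increments, and
`exitStopped_concat` computes the stopped process pathwise: with `r = τ(ω)`,

`F^n_t(ω ∗_r ω') = F^n_{t ∧ r}(ω) + 1_{r < τ_n(ω)} F_{ρ ∧ (t - r)}(ω')`,

where `ρ` is the first time at which `|F_r(ω) + F(ω')|` reaches the level `n`, capped at `n - r`.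
Optional stopping of `F^n` at `τ` under `μ` handles the first summand. As `|F_r(ω)| < n`, the time
`ρ` does not exceed `τ_{2n}(ω')`, so the second summand is the bounded martingale `F^{2n}` under
`κ_ω` stopped at `ρ`; an event of `ℱ_s`, read as an event for `ω'`, lies in `ℱ_{s - r}` if `r < s`,
and is decided by `ω` if `s ≤ r`, when the second summand starts from zero
(`TCSpace.integral_indicator_increment_concat`). Fubini then gives the martingale property.

The difficulty is measurability: hitting times of closed sets by càdlàg paths are not stopping
times of the raw filtration. The event that such a path reaches a level before `t` is however the
projection of a Borel set, hence analytic, hence measurable up to null sets for every finite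
measure (`MeasureTheory.AnalyticSet.nullMeasurableSet`, by Choquet's capacitability argument); it is
also invariant under `T_t`, and therefore in `ℱ_t` up to null sets. Optional stopping is proved in
this generality (`setIntegral_apply_min_eq`), by approximating the stopping time from the right by
times with countably many values.
-/

/-! ### Universal measurability of analytic sets and of projections -/

theorem isCompact_setOf_forall_le (b : ℕ → ℕ) : IsCompact {x : ℕ → ℕ | ∀ i, x i ≤ b i} := by
  have : {x : ℕ → ℕ | ∀ i, x i ≤ b i} = Set.univ.pi fun i => Set.Iic (b i) := by
    ext x
    simp [Pi.le_def]
  rw [this]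
  exact isCompact_univ_pi fun i => (Set.finite_Iic _).isCompact

/-- An open neighbourhood of the compact box `{x | ∀ i, x i ≤ b i}` of Baire space contains the set
of all sequences that satisfy finitely many of these constraints. -/
theorem exists_forall_lt_le_subset_of_isOpen {b : ℕ → ℕ} {O : Set (ℕ → ℕ)} (hO : IsOpen O)
    (h : {x : ℕ → ℕ | ∀ i, x i ≤ b i} ⊆ O) :
    ∃ k, {x : ℕ → ℕ | ∀ i < k, x i ≤ b i} ⊆ O := by
  -- Compactness gives one `k` such that agreeing up to `k` with a point of the box forces
  -- membership in `O`.
  have key : ∃ k, ∀ z : ℕ → ℕ,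
      (∃ x ∈ {x : ℕ → ℕ | ∀ i, x i ≤ b i}, ∀ i < k, z i = x i) → z ∈ O := by
    refine (isCompact_setOf_forall_le b).induction_on
      (p := fun s => ∃ k, ∀ z : ℕ → ℕ, (∃ x ∈ s, ∀ i < k, z i = x i) → z ∈ O)
      ⟨0, by simp⟩ ?_ ?_ ?_
    · rintro s t hst ⟨k, hk⟩
      exact ⟨k, fun z ⟨x, hx, hz⟩ => hk z ⟨x, hst hx, hz⟩⟩
    · rintro s t ⟨k, hk⟩ ⟨l, hl⟩
      refine ⟨max k l, ?_⟩
      rintro z ⟨x, hx | hx, hz⟩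
      · exact hk z ⟨x, hx, fun i hi => hz i (lt_max_of_lt_left hi)⟩
      · exact hl z ⟨x, hx, fun i hi => hz i (lt_max_of_lt_right hi)⟩
    · intro x hx
      obtain ⟨u, ⟨y, k, rfl⟩, hxu, hu⟩ :=
        (PiNat.isTopologicalBasis_cylinders (fun _ : ℕ => ℕ)).exists_subset_of_mem_open (h hx) hO
      refine ⟨PiNat.cylinder y k, mem_nhdsWithin_of_mem_nhds
        ((PiNat.isOpen_cylinder _ y k).mem_nhds hxu), k, ?_⟩
      rintro z ⟨w, hw, hz⟩
      exact hu fun i hi => (hz i hi).trans (hw i hi)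
  obtain ⟨k, hk⟩ := key
  refine ⟨k, fun z hz => hk z ⟨fun i => min (z i) (b i), fun i => min_le_right _ _, fun i hi => ?_⟩⟩
  exact (min_eq_left (hz i hi)).symm

/-- Capacitability of analytic sets: they are inner regular with respect to compact sets. -/
theorem MeasureTheory.AnalyticSet.exists_isCompact_measure_ge {α : Type*}
    [TopologicalSpace α] [T2Space α] [MeasurableSpace α] [OpensMeasurableSpace α] {s : Set α}
    (hs : AnalyticSet s)
    (μ : Measure α) [IsFiniteMeasure μ] {c : ℝ≥0∞} (hc : c < μ s) :
    ∃ K ⊆ s, IsCompact K ∧ c ≤ μ K := by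
  rw [AnalyticSet] at hs
  rcases hs with rfl | ⟨f, hf, rfl⟩
  · simp at hc
  -- Bounding one more coordinate keeps the outer measure above `c`, since outer measure is
  -- continuous along increasing unions of arbitrary sets.
  have step : ∀ (V : Set (ℕ → ℕ)) (k : ℕ), c < μ (f '' V) →
      ∃ m, c < μ (f '' (V ∩ {x | x k ≤ m})) := by
    intro V k hV
    have hU : f '' V = ⋃ m : ℕ, f '' (V ∩ {x | x k ≤ m}) := by
      rw [← Set.image_iUnion, ← Set.inter_iUnion]
      congr 1
      ext x
      simp only [Set.mem_inter_iff, Set.mem_iUnion, Set.mem_ofPred_eq]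
      exact ⟨fun h => ⟨h, x k, le_rfl⟩, fun h => h.1⟩
    have hmono : Monotone fun m : ℕ => f '' (V ∩ {x | x k ≤ m}) := fun m m' h =>
      Set.image_mono (Set.inter_subset_inter_right _ fun x (hx : x k ≤ m) => hx.trans h)
    rw [hU, hmono.measure_iUnion] at hV
    exact lt_iSup_iff.1 hV
  choose! m hm using step
  let V : ℕ → Set (ℕ → ℕ) := fun k =>
    k.rec Set.univ fun k W => W ∩ {x | x k ≤ m W k}
  have hVs : ∀ k, V (k + 1) = V k ∩ {x | x k ≤ m (V k) k} := fun _ => rfl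
  have hVc : ∀ k, c < μ (f '' V k) := by
    intro k
    induction k with
    | zero => simpa [V] using hc
    | succ k ih => rw [hVs]; exact hm _ _ ih
  set b : ℕ → ℕ := fun k => m (V k) k with hb
  have hV : ∀ k, V k = {x | ∀ i < k, x i ≤ b i} := by
    intro k
    induction k with
    | zero => simp [V]
    | succ k ih =>
      rw [hVs, ih]
      ext x
      simp only [Set.mem_inter_iff, Set.mem_ofPred_eq, Nat.lt_succ_iff_lt_or_eq]
      rw [← ih]
      exact ⟨fun h i hi => hi.elim (h.1 i) (by rintro rfl; exact h.2),
        fun h => ⟨fun i hi => h i (Or.inl hi), h k (Or.inr rfl)⟩⟩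
  have hfK := (isCompact_setOf_forall_le b).image hf
  refine ⟨f '' {x | ∀ i, x i ≤ b i}, Set.image_subset_range _ _, hfK, ?_⟩
  -- A point outside the image of the box is separated from it, hence from the image of a stage.
  have hinter : ⋂ k, closure (f '' V k) ⊆ f '' {x | ∀ i, x i ≤ b i} := by
    intro y hy
    by_contra hyK
    have hd : Disjoint (f '' {x | ∀ i, x i ≤ b i}) {y} := by simpa using hyK
    obtain ⟨U, W, hU, hW, hKU, hyW, hUW⟩ :=
      SeparatedNhds.of_isCompact_isCompact hfK isCompact_singleton hd
    obtain ⟨k, hk⟩ := exists_forall_lt_le_subset_of_isOpen (hU.preimage hf)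
      (Set.image_subset_iff.1 hKU)
    have hyk := Set.mem_iInter.1 hy k
    rw [mem_closure_iff] at hyk
    obtain ⟨z, hzW, x, hx, rfl⟩ := hyk W hW (hyW rfl)
    rw [hV] at hx
    exact Set.disjoint_left.1 hUW (hk hx) hzW
  refine le_trans ?_ (measure_mono hinter)
  have hanti : Antitone fun k => closure (f '' V k) := by
    intro k l hkl
    refine closure_mono (Set.image_mono ?_)
    rw [hV, hV]
    exact fun x hx i hi => hx i (hi.trans_le hkl)
  rw [hanti.measure_iInter (fun k => isClosed_closure.measurableSet.nullMeasurableSet)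
    ⟨0, measure_ne_top _ _⟩]
  exact le_iInf fun k => (hVc k).le.trans (measure_mono subset_closure)

theorem MeasureTheory.AnalyticSet.nullMeasurableSet {α : Type*} [TopologicalSpace α] [T2Space α]
    [MeasurableSpace α] [OpensMeasurableSpace α] {s : Set α} (hs : AnalyticSet s)
    (μ : Measure α) [IsFiniteMeasure μ] : NullMeasurableSet s μ := by
  by_cases h0 : μ s = 0
  · exact NullMeasurableSet.of_null h0
  obtain ⟨u, -, hu, hlim⟩ := exists_seq_strictMono_tendsto' (pos_iff_ne_zero.2 h0)
  choose K hKs hK hle using fun n => hs.exists_isCompact_measure_ge μ (hu n).2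
  have hmeas : NullMeasurableSet (⋃ n, K n) μ :=
    NullMeasurableSet.iUnion fun n => (hK n).measurableSet.nullMeasurableSet
  have hge : μ s ≤ μ (⋃ n, K n) :=
    le_of_tendsto' hlim fun n => (hle n).trans (measure_mono (Set.subset_iUnion K n))
  exact hmeas.congr (ae_eq_of_subset_of_measure_ge (Set.iUnion_subset hKs) hge hmeas
    (measure_ne_top _ _))

/-- Measurable projection theorem. -/
theorem nullMeasurableSet_exists_prodMk_mem {T Ω : Type*} [MeasurableSpace T]
    [StandardBorelSpace T] [MeasurableSpace Ω] [StandardBorelSpace Ω] {A : Set (T × Ω)}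
    (hA : MeasurableSet A) (μ : Measure Ω) [IsFiniteMeasure μ] :
    NullMeasurableSet {ω | ∃ t, (t, ω) ∈ A} μ := by
  let := upgradeStandardBorel Ω
  have h : {ω | ∃ t, (t, ω) ∈ A} = Prod.snd '' A := by
    ext ω
    simp
  rw [h]
  exact (hA.analyticSet_image measurable_snd).nullMeasurableSet μ

/-! ### Universally measurable kernels -/

/-- Along a measurable map, a universally measurable kernel agrees almost everywhere with a
measurable Markov kernel. -/
theorem IsUniversalKernel.exists_kernel_ae_eq {Ω Ω' : Type*} [MeasurableSpace Ω]
    [StandardBorelSpace Ω] [MeasurableSpace Ω'] {ν : Ω → Measure Ω} (hν : IsUniversalKernel ν)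
    (μ : Measure Ω') [IsProbabilityMeasure μ] {g : Ω' → Ω} (hg : Measurable g) :
    ∃ κ : Kernel Ω' Ω, IsMarkovKernel κ ∧ ∀ᵐ ω ∂μ, κ ω = ν (g ω) := by
  have hρ : IsProbabilityMeasure (μ.map g) := Measure.isProbabilityMeasure_map hg.aemeasurable
  obtain ⟨ω₀⟩ : Nonempty Ω := nonempty_of_isProbabilityMeasure (μ.map g)
  obtain ⟨b, hb, hgen⟩ := MeasurableSpace.CountablyGenerated.isCountablyGenerated (α := Ω)
  set 𝒜 := generateSetAlgebra b
  have h𝒜 : 𝒜.Countable := countable_generateSetAlgebra hb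
  have h𝒜gen : ‹MeasurableSpace Ω› = MeasurableSpace.generateFrom 𝒜 :=
    hgen.trans generateFrom_generateSetAlgebra_eq.symm
  have h𝒜m : ∀ B ∈ 𝒜, MeasurableSet B := fun B hB => by
    rw [h𝒜gen]
    exact MeasurableSpace.measurableSet_generateFrom hB
  have hpi : IsPiSystem 𝒜 := fun s hs t ht _ =>
    isSetAlgebra_generateSetAlgebra.inter_mem hs ht
  have hae : ∀ B ∈ 𝒜, ∃ f : Ω → ℝ≥0∞, Measurable f ∧ ∀ᵐ ω ∂(μ.map g), ν ω B = f ω :=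
    fun B hB => (hν.2 B (h𝒜m B hB) _ hρ).aemeasurable
  choose! f hfm hf using hae
  -- Countably many null sets are removed; a probability measure is determined on the algebra.
  have hall : ∀ᵐ ω ∂(μ.map g), ∀ B ∈ 𝒜, ν ω B = f B ω := (ae_ball_iff h𝒜).2 hf
  obtain ⟨N, hN, hNm, hN0⟩ := exists_measurable_superset_of_null (ae_iff.1 hall)
  have hNf : ∀ ω ∉ N, ∀ B ∈ 𝒜, ν ω B = f B ω := fun ω hω => by
    by_contra h
    exact hω (hN h)
  classical
  let ν' : Ω → Measure Ω := N.piecewise (fun _ => Measure.dirac ω₀) ν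
  have hprob : ∀ ω, IsProbabilityMeasure (ν' ω) := by
    intro ω
    by_cases hω : ω ∈ N
    · simp only [ν', Set.piecewise_eq_of_mem _ _ _ hω]
      infer_instance
    · simp only [ν', Set.piecewise_eq_of_notMem _ _ _ hω]
      exact hν.1 ω
  have hmeas : Measurable ν' := by
    refine Measurable.measure_of_isPiSystem_of_isProbabilityMeasure h𝒜gen hpi fun B hB => ?_
    have : (fun ω => ν' ω B) = N.piecewise (fun _ => Measure.dirac ω₀ B) (f B) := by
      ext ω
      by_cases hω : ω ∈ N
      · simp [ν', hω]
      · simp [ν', hω, hNf ω hω B hB]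
    rw [this]
    exact Measurable.piecewise hNm measurable_const (hfm B hB)
  refine ⟨⟨fun ω => ν' (g ω), hmeas.comp hg⟩, ⟨fun ω => hprob (g ω)⟩, ?_⟩
  have hNμ : ∀ᵐ ω ∂μ, g ω ∉ N := by
    rw [Measure.map_apply hg hNm] at hN0
    exact measure_eq_zero_iff_ae_notMem.1 hN0
  filter_upwards [hNμ] with ω hω
  exact Set.piecewise_eq_of_notMem N (fun _ => Measure.dirac ω₀) ν hω

/-! ### The two time sets -/

namespace IsTimeSet

variable {𝕋 : Type} [CommSemiring 𝕋] [LinearOrder 𝕋] [InfSet 𝕋] [Sub 𝕋]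
  [TopologicalSpace 𝕋] [MeasurableSpace 𝕋] [h𝕋 : IsTimeSet 𝕋]

instance : OrderTopology 𝕋 := by cases h𝕋 <;> infer_instance

instance : BorelSpace 𝕋 := by cases h𝕋 <;> infer_instance

instance : PolishSpace 𝕋 := by cases h𝕋 <;> infer_instance

instance : IsStrictOrderedRing 𝕋 := by cases h𝕋 <;> infer_instance

instance : CanonicallyOrderedAdd 𝕋 := by cases h𝕋 <;> infer_instance

instance : OrderedSub 𝕋 := by cases h𝕋 <;> infer_instance

theorem exists_le_natCast (t : 𝕋) : ∃ n : ℕ, t ≤ n := by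
  cases h𝕋 with
  | nnreal => exact exists_nat_ge t
  | nat => exact ⟨t, le_rfl⟩

theorem sInf_le {s : Set 𝕋} {t : 𝕋} (ht : t ∈ s) : sInf s ≤ t := by
  cases h𝕋 with
  | nnreal => exact csInf_le (OrderBot.bddBelow s) ht
  | nat => exact Nat.sInf_le ht

/-- The infimum of a nonempty set that is closed under limits from the right is attained. -/
theorem sInf_mem {s : Set 𝕋} (hs : s.Nonempty)
    (h : ∀ t ∉ s, ∀ᶠ r in 𝓝[≥] t, r ∉ s) : sInf s ∈ s := by
  cases h𝕋 with
  | nnreal =>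
    by_contra hmem
    obtain ⟨u, hu, hsub⟩ := mem_nhdsGE_iff_exists_Ico_subset.1 (h _ hmem)
    obtain ⟨r, hr, hru⟩ := exists_lt_of_csInf_lt hs hu
    exact hsub ⟨csInf_le (OrderBot.bddBelow s) hr, hru⟩ hr
  | nat => exact Nat.sInf_mem hs

/-- Rounding up to finer and finer grids. The maps `d k` take countably many values and decrease to
the identity; each has an upper adjoint `e k`, the rounding down to the same grid. -/
theorem exists_rounding : ∃ d e : ℕ → 𝕋 → 𝕋, (∀ k, (Set.range (d k)).Countable) ∧
    (∀ k r u, d k r ≤ u ↔ r ≤ e k u) ∧ (∀ k r, r ≤ d k r) ∧ (∀ k u, e k u ≤ u) ∧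
    ∀ r, Tendsto (fun k => d k r) atTop (𝓝 r) := by
  cases h𝕋 with
  | nat =>
    exact ⟨fun _ r => r, fun _ r => r, fun _ => Set.to_countable _, fun _ _ _ => Iff.rfl,
      fun _ _ => le_rfl, fun _ _ => le_rfl, fun _ => tendsto_const_nhds⟩
  | nnreal =>
    have hk : ∀ k : ℕ, (0 : ℝ≥0) < k + 1 := fun k => by positivity
    have hle : ∀ (k : ℕ) (r : ℝ≥0), r ≤ (⌈r * (k + 1)⌉₊ : ℝ≥0) / (k + 1) := fun k r => by
      rw [le_div_iff₀ (hk k)]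
      exact Nat.le_ceil _
    refine ⟨fun k r => (⌈r * (k + 1)⌉₊ : ℝ≥0) / (k + 1),
      fun k r => (⌊r * (k + 1)⌋₊ : ℝ≥0) / (k + 1), fun k => ?_, fun k r u => ?_, hle,
      fun k u => ?_, fun r => ?_⟩
    · refine (Set.countable_range fun m : ℕ => (m : ℝ≥0) / (k + 1)).mono ?_
      rintro _ ⟨r, rfl⟩
      exact ⟨_, rfl⟩
    · rw [div_le_iff₀ (hk k), le_div_iff₀ (hk k), ← Nat.le_floor_iff (by positivity), Nat.ceil_le]
    · rw [div_le_iff₀ (hk k)]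
      exact Nat.floor_le (by positivity)
    · have hlim : Tendsto (fun k : ℕ => r + 1 / ((k : ℝ≥0) + 1)) atTop (𝓝 (r + 0)) :=
        tendsto_const_nhds.add tendsto_one_div_add_atTop_nhds_zero_nat
      rw [add_zero] at hlim
      refine tendsto_of_tendsto_of_tendsto_of_le_of_le tendsto_const_nhds hlim
        (fun k => hle k r) fun k => ?_
      simp only
      rw [div_le_iff₀ (hk k), add_mul, one_div, inv_mul_cancel₀ (hk k).ne']
      exact (Nat.ceil_lt_add_one (by positivity)).le

end IsTimeSet

/-! ### Exit times of right-continuous paths -/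

/-- The first time at which `|a + y|` reaches the level `n`, capped at the horizon `N`. -/
def hitTime {𝕋 : Type} [LinearOrder 𝕋] [InfSet 𝕋] (a : ℝ) (n : ℕ) (N : 𝕋) (y : 𝕋 → ℝ) : 𝕋 :=
  sInf ({t | (n : ℝ) ≤ |a + y t|} ∪ {N})

theorem exitTime_eq_hitTime {𝕋 : Type} [CommSemiring 𝕋] [LinearOrder 𝕋] [InfSet 𝕋] (n : ℕ)
    (y : 𝕋 → ℝ) : exitTime n y = hitTime 0 n (n : 𝕋) y := by
  simp [exitTime, hitTime]

section HitTime

variable {𝕋 : Type} [CommSemiring 𝕋] [LinearOrder 𝕋] [InfSet 𝕋] [Sub 𝕋]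
  [TopologicalSpace 𝕋] [MeasurableSpace 𝕋] [h𝕋 : IsTimeSet 𝕋]

/-- The level is a closed set and the path is right-continuous, so the infimum defining the hitting
time is attained. -/
theorem hitTime_le_iff {a : ℝ} {n : ℕ} {N : 𝕋} {y : 𝕋 → ℝ}
    (hy : ∀ t, ContinuousWithinAt y (Set.Ici t) t) {u : 𝕋} :
    hitTime a n N y ≤ u ↔ (∃ q ≤ u, (n : ℝ) ≤ |a + y q|) ∨ N ≤ u := by
  constructor
  · intro hu
    have hmem : hitTime a n N y ∈ {t | (n : ℝ) ≤ |a + y t|} ∪ {N} := by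
      refine IsTimeSet.sInf_mem ⟨N, Or.inr rfl⟩ fun t ht => ?_
      simp only [Set.mem_union, Set.mem_ofPred_eq, Set.mem_singleton_iff, not_or, not_le] at ht
      have hc : ContinuousWithinAt (fun r => |a + y r|) (Set.Ici t) t :=
        (continuousWithinAt_const.add (hy t)).abs
      filter_upwards [hc.eventually_lt_const ht.1,
        mem_nhdsWithin_of_mem_nhds (isOpen_ne.mem_nhds ht.2)] with r hr1 hr2
      simp only [Set.mem_union, Set.mem_ofPred_eq, Set.mem_singleton_iff, not_or, not_le]
      exact ⟨hr1, hr2⟩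
    rcases hmem with h | h
    · exact Or.inl ⟨_, hu, h⟩
    · exact Or.inr (h ▸ hu)
  · have hle : ∀ s ∈ ({t | (n : ℝ) ≤ |a + y t|} ∪ {N} : Set 𝕋), hitTime a n N y ≤ s :=
      fun s hs => IsTimeSet.sInf_le hs
    rintro (⟨q, hq, h⟩ | h)
    · exact (hle q (Or.inl h)).trans hq
    · exact (hle N (Or.inr rfl)).trans h

theorem exitTime_le_iff {n : ℕ} {y : 𝕋 → ℝ} (hy : ∀ t, ContinuousWithinAt y (Set.Ici t) t)
    {u : 𝕋} : exitTime n y ≤ u ↔ (∃ q ≤ u, (n : ℝ) ≤ |y q|) ∨ (n : 𝕋) ≤ u := by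
  rw [exitTime_eq_hitTime, hitTime_le_iff hy]
  simp

/-- A path shifted by `a`, `|a| ≤ n`, reaches the level `n` before the path itself reaches the
level `2 n`. -/
theorem hitTime_le_exitTime {a : ℝ} {n : ℕ} {N : 𝕋} {y : 𝕋 → ℝ}
    (hy : ∀ t, ContinuousWithinAt y (Set.Ici t) t) (ha : |a| ≤ n) (hN : N ≤ n) :
    hitTime a n N y ≤ exitTime (2 * n) y := by
  rw [hitTime_le_iff hy]
  rcases (exitTime_le_iff hy).1 (le_refl (exitTime (2 * n) y)) with ⟨q, hq, h⟩ | h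
  · refine Or.inl ⟨q, hq, ?_⟩
    push_cast at h
    have := abs_sub_abs_le_abs_sub (y q) (-a)
    rw [abs_neg, sub_neg_eq_add, add_comm] at this
    rw [add_comm a] at *
    linarith
  · refine Or.inr (hN.trans (le_trans ?_ h))
    exact_mod_cast Nat.cast_le.2 (by omega : n ≤ 2 * n)

/-- The stopped process of a concatenated path: it is the stopped first path until the time `r` of
concatenation; if that path has not left `(-n, n)` by then, the second path is added, stopped when
the sum leaves `(-n, n)`. -/
theorem exitStopped_concat {x y : 𝕋 → ℝ} (hx : ∀ t, ContinuousWithinAt x (Set.Ici t) t)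
    (hy : ∀ t, ContinuousWithinAt y (Set.Ici t) t) (hy0 : y 0 = 0) {r : 𝕋}
    {z : 𝕋 → ℝ} (hz : ∀ t, ContinuousWithinAt z (Set.Ici t) t)
    (hle : ∀ s ≤ r, z s = x s) (hgt : ∀ s, r ≤ s → z s = x r + y (s - r)) (n : ℕ) (t : 𝕋) :
    exitStopped n z t = exitStopped n x (min t r) +
      if r < exitTime n x then y (min (hitTime (x r) n (n - r) y) (t - r)) else 0 := by
  -- Up to time `r` the two paths agree, hence so do their exits up to time `r`.
  have hbefore : ∀ u ≤ r, (exitTime n z ≤ u ↔ exitTime n x ≤ u) := by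
    intro u hu
    rw [exitTime_le_iff hz, exitTime_le_iff hx]
    refine or_congr_left (exists_congr fun q => and_congr_right fun hq => ?_)
    rw [hle q (hq.trans hu)]
  split_ifs with hr
  · have hrz : r < exitTime n z := by
      rw [← not_le] at hr ⊢
      rwa [hbefore r le_rfl]
    have hx' := hr
    rw [← not_le, exitTime_le_iff hx] at hx'
    push Not at hx'
    simp only [exitStopped]
    rw [min_eq_right ((min_le_right t r).trans hr.le)]
    rcases le_total t r with htr | hrt
    · rw [min_eq_right (htr.trans hrz.le), min_eq_left htr, tsub_eq_zero_of_le htr, hle t htr,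
        min_eq_right zero_le, hy0, add_zero]
    · rw [hgt _ (le_min hrz.le hrt), min_eq_right hrt]
      congr 2
      -- After the time of concatenation the exit time is the shifted hitting time.
      have hiff : ∀ u, exitTime n z ≤ r + u ↔ hitTime (x r) n (n - r) y ≤ u := by
        intro u
        rw [exitTime_le_iff hz, hitTime_le_iff hy, tsub_le_iff_left]
        refine or_congr_left ⟨?_, ?_⟩
        · rintro ⟨q, hq, h⟩
          rcases le_total q r with hqr | hrq
          · rw [hle q hqr] at h
            exact absurd h (not_le.2 (hx'.1 q hqr))
          · rw [hgt q hrq] at h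
            exact ⟨q - r, tsub_le_iff_left.2 hq, h⟩
        · rintro ⟨q, hq, h⟩
          refine ⟨r + q, by gcongr, ?_⟩
          rw [hgt _ le_self_add, add_tsub_cancel_left]
          exact h
      refine eq_of_forall_ge_iff fun u => ?_
      rw [tsub_le_iff_left, min_le_iff, min_le_iff, hiff, tsub_le_iff_left]
  · rw [not_lt] at hr
    have heq : exitTime n z = exitTime n x :=
      le_antisymm ((hbefore _ hr).2 le_rfl)
        ((hbefore _ (((hbefore _ hr).2 le_rfl).trans hr)).1 le_rfl)
    simp only [exitStopped]
    rw [heq, hle _ ((min_le_left _ _).trans hr), add_zero, min_comm t r, ← min_assoc,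
      min_eq_left hr]

end HitTime

section Stopped

variable {𝕋 : Type} [CommSemiring 𝕋] [LinearOrder 𝕋] [InfSet 𝕋] [Sub 𝕋]
  [TopologicalSpace 𝕋] [MeasurableSpace 𝕋] [h𝕋 : IsTimeSet 𝕋]

/-- The value at `t` of a stopped path depends only on the path up to `t`. -/
theorem exitStopped_congr {x z : 𝕋 → ℝ} (hx : ∀ t, ContinuousWithinAt x (Set.Ici t) t)
    (hz : ∀ t, ContinuousWithinAt z (Set.Ici t) t) {t : 𝕋} (h : ∀ s ≤ t, z s = x s) (n : ℕ) :
    exitStopped n z t = exitStopped n x t := by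
  have hmin : min (exitTime n z) t = min (exitTime n x) t := by
    refine eq_of_forall_ge_iff fun u => ?_
    rw [min_le_iff, min_le_iff]
    rcases le_total t u with htu | hut
    · simp [htu]
    · refine or_congr_left ?_
      rw [exitTime_le_iff hz, exitTime_le_iff hx]
      refine or_congr_left (exists_congr fun q => and_congr_right fun hq => ?_)
      rw [h q (hq.trans hut)]
  simp only [exitStopped]
  rw [hmin, h _ (min_le_right _ _)]

theorem continuousWithinAt_exitStopped {x : 𝕋 → ℝ}
    (hx : ∀ t, ContinuousWithinAt x (Set.Ici t) t) (n : ℕ) (t : 𝕋) :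
    ContinuousWithinAt (exitStopped n x) (Set.Ici t) t :=
  ContinuousWithinAt.comp (t := Set.Ici (min (exitTime n x) t)) (hx _)
    (by fun_prop) fun _ hr => min_le_min_left _ hr

end Stopped

/-! ### Measurability of stopped morphisms up to null sets -/

section JointMeasurability

variable {𝕋 : Type} [CommSemiring 𝕋] [LinearOrder 𝕋] [InfSet 𝕋] [Sub 𝕋]
  [TopologicalSpace 𝕋] [MeasurableSpace 𝕋] [h𝕋 : IsTimeSet 𝕋]

/-- The value at `t` is the limit of the values at `t` rounded up to finer and finer grids. -/
theorem measurable_uncurry_of_rightContinuous {Ω : Type*} [MeasurableSpace Ω] {f : 𝕋 → Ω → ℝ}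
    (hf : ∀ t, Measurable (f t)) (hc : ∀ ω t, ContinuousWithinAt (f · ω) (Set.Ici t) t) :
    Measurable fun p : 𝕋 × Ω => f p.1 p.2 := by
  obtain ⟨d, e, hd, hde, hle, -, hlim⟩ := IsTimeSet.exists_rounding (𝕋 := 𝕋)
  have hdm : ∀ k, Measurable (d k) := fun k => by
    refine measurable_of_Iic fun u => ?_
    have : d k ⁻¹' Set.Iic u = Set.Iic (e k u) := by
      ext r
      exact hde k r u
    rw [this]
    exact measurableSet_Iic
  refine measurable_of_tendsto_metrizable (f := fun k (p : 𝕋 × Ω) => f (d k p.1) p.2)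
    (fun k => ?_) ?_
  · have := (hd k).to_subtype
    have h1 : Measurable fun p : Set.range (d k) × Ω => f p.1 p.2 :=
      measurable_from_prod_countable_right fun u => hf u
    have h2 : Measurable fun p : 𝕋 × Ω => ((⟨d k p.1, p.1, rfl⟩ : Set.range (d k)), p.2) :=
      (((hdm k).comp measurable_fst).subtype_mk).prodMk measurable_snd
    exact h1.comp h2
  · rw [tendsto_pi_nhds]
    rintro ⟨t, ω⟩
    exact (hc ω t).tendsto.comp
      (tendsto_nhdsWithin_iff.2 ⟨hlim t, Eventually.of_forall fun k => hle k t⟩)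

end JointMeasurability

namespace TCSpace

section Truncation

variable {𝕋 Ω : Type*} [AddCommMonoid 𝕋] [LinearOrder 𝕋] [Sub 𝕋] [MeasurableSpace 𝕋]
  [MeasurableSpace Ω]

theorem measurable_trunc_apply (S : TCSpace 𝕋 Ω) (t : 𝕋) : Measurable (S.trunc t) :=
  S.measurable_trunc.comp (measurable_const.prodMk measurable_id)

/-- A universally measurable event that depends on the past up to `t` only belongs to `ℱ_t` up to
null sets. -/
theorem eventuallyMeasurableSet_of_trunc (S : TCSpace 𝕋 Ω) {t : 𝕋} {A : Set Ω}
    (hA : ∀ ω, S.trunc t ω ∈ A ↔ ω ∈ A)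
    (hAm : ∀ (μ : Measure Ω) [IsFiniteMeasure μ], NullMeasurableSet A μ)
    (μ : Measure Ω) [IsFiniteMeasure μ] : EventuallyMeasurableSet (S.filtration t) (ae μ) A := by
  obtain ⟨B, hB, hAB⟩ := hAm (μ.map (S.trunc t))
  refine ⟨S.trunc t ⁻¹' B, ?_, ?_⟩
  · rw [S.filtration_eq]
    exact ⟨B, hB, rfl⟩
  · have h := ae_of_ae_map (S.measurable_trunc_apply t).aemeasurable hAB.mem_iff
    rw [eventuallyEq_set]
    filter_upwards [h] with ω hω
    rw [← hA]
    exact hω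

theorem aestronglyMeasurable_of_trunc (S : TCSpace 𝕋 Ω) {t : 𝕋} {f : Ω → ℝ}
    (hf : ∀ ω, f (S.trunc t ω) = f ω)
    (hfm : ∀ (μ : Measure Ω) [IsFiniteMeasure μ], AEMeasurable f μ)
    (μ : Measure Ω) [IsFiniteMeasure μ] : AEStronglyMeasurable[S.filtration t] f μ := by
  obtain ⟨g, hg, hfg⟩ := hfm (μ.map (S.trunc t))
  refine ⟨g ∘ S.trunc t, ?_, ?_⟩
  · have : Measurable[S.filtration t] (S.trunc t) := by
      rw [S.filtration_eq]
      exact comap_measurable _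
    exact (hg.comp this).stronglyMeasurable
  · filter_upwards [ae_of_ae_map (S.measurable_trunc_apply t).aemeasurable hfg] with ω hω
    rw [← hf]
    exact hω

end Truncation

section Morphism

variable {𝕋 : Type} [CommSemiring 𝕋] [LinearOrder 𝕋] [InfSet 𝕋] [Sub 𝕋]
  [TopologicalSpace 𝕋] [MeasurableSpace 𝕋] [h𝕋 : IsTimeSet 𝕋] {Ω : Type*} [MeasurableSpace Ω]
  {S : TCSpace 𝕋 Ω} {F : Ω → CadlagZero 𝕋}

theorem measurable_eval (hF : S.IsNonAnticipating (cadlagZeroOps 𝕋) F) (t : 𝕋) :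
    Measurable fun ω => (F ω).1 t :=
  ((measurable_pi_apply t).comp measurable_subtype_coe).comp hF.1

/-- By non-anticipation, `F` up to time `t` depends on `ω` through `T_t ω` only. -/
theorem apply_trunc_of_le (hF : S.IsNonAnticipating (cadlagZeroOps 𝕋) F) {s t : 𝕋} (hst : s ≤ t)
    (ω : Ω) : (F (S.trunc t ω)).1 s = (F ω).1 s := by
  have h1 : Measurable[MeasurableSpace.comap ((cadlagZeroOps 𝕋).trunc t) inferInstance]
      fun y : CadlagZero 𝕋 => ((cadlagZeroOps 𝕋).trunc t y).1 s := by
    have h0 : Measurable fun y : CadlagZero 𝕋 => y.1 s :=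
      (measurable_pi_apply s).comp measurable_subtype_coe
    exact h0.comp (comap_measurable _)
  have h2 := (h1.comp (hF.2 t)).factorsThrough
  have h3 := @h2 (S.trunc t ω) ω (by rw [S.trunc_trunc, min_self])
  simpa [cadlagZeroOps, min_eq_left hst] using h3

theorem measurable_uncurry_eval (hF : S.IsNonAnticipating (cadlagZeroOps 𝕋) F) :
    Measurable fun p : 𝕋 × Ω => (F p.2).1 p.1 :=
  measurable_uncurry_of_rightContinuous (f := fun t ω => (F ω).1 t) (measurable_eval hF)
    fun ω => (F ω).2.1.1

/-- The event that `|a + F|` reaches the level `n` before `t` is the projection of a Borel set. -/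
theorem nullMeasurableSet_hitTime_le (hF : S.IsNonAnticipating (cadlagZeroOps 𝕋) F) (a : ℝ)
    (n : ℕ) (N t : 𝕋) (μ : Measure Ω) [IsFiniteMeasure μ] :
    NullMeasurableSet {ω | hitTime a n N (F ω).1 ≤ t} μ := by
  have := S.standardBorel
  have h : {ω | hitTime a n N (F ω).1 ≤ t} =
      {ω | ∃ q, (q, ω) ∈ {p : 𝕋 × Ω | p.1 ≤ t ∧ (n : ℝ) ≤ |a + (F p.2).1 p.1|}} ∪
        {_ω | N ≤ t} := by
    ext ω
    exact hitTime_le_iff (F ω).2.1.1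
  rw [h]
  have hm := measurable_uncurry_eval hF
  refine (nullMeasurableSet_exists_prodMk_mem ?_ μ).union (MeasurableSet.const _).nullMeasurableSet
  exact (measurableSet_le measurable_fst measurable_const).inter
    (measurableSet_le measurable_const (measurable_const.add hm).abs)

theorem eventuallyMeasurableSet_hitTime_le (hF : S.IsNonAnticipating (cadlagZeroOps 𝕋) F) (a : ℝ)
    (n : ℕ) (N t : 𝕋) (μ : Measure Ω) [IsFiniteMeasure μ] :
    EventuallyMeasurableSet (S.filtration t) (ae μ) {ω | hitTime a n N (F ω).1 ≤ t} := by
  refine S.eventuallyMeasurableSet_of_trunc (fun ω => ?_)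
    (fun μ _ => nullMeasurableSet_hitTime_le hF a n N t μ) μ
  simp only [Set.mem_ofPred_eq]
  rw [hitTime_le_iff (F _).2.1.1, hitTime_le_iff (F _).2.1.1]
  refine or_congr_left (exists_congr fun q => and_congr_right fun hq => ?_)
  rw [apply_trunc_of_le hF hq]

theorem aemeasurable_exitTime (hF : S.IsNonAnticipating (cadlagZeroOps 𝕋) F) (n : ℕ)
    (μ : Measure Ω) [IsFiniteMeasure μ] : AEMeasurable (fun ω => exitTime n (F ω).1) μ := by
  refine NullMeasurable.aemeasurable ?_
  refine measurable_of_Iic (δ := NullMeasurableSpace Ω μ) fun u => ?_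
  simp only [exitTime_eq_hitTime]
  exact nullMeasurableSet_hitTime_le hF 0 n n u μ

theorem aemeasurable_exitStopped (hF : S.IsNonAnticipating (cadlagZeroOps 𝕋) F) (n : ℕ) (t : 𝕋)
    (μ : Measure Ω) [IsFiniteMeasure μ] : AEMeasurable (fun ω => exitStopped n (F ω).1 t) μ :=
  (measurable_uncurry_eval hF).comp_aemeasurable
    (((aemeasurable_exitTime hF n μ).min aemeasurable_const).prodMk aemeasurable_id)

theorem aestronglyMeasurable_exitStopped (hF : S.IsNonAnticipating (cadlagZeroOps 𝕋) F) (n : ℕ)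
    (t : 𝕋) (μ : Measure Ω) [IsFiniteMeasure μ] :
    AEStronglyMeasurable[S.filtration t] (fun ω => exitStopped n (F ω).1 t) μ := by
  refine S.aestronglyMeasurable_of_trunc (fun ω => ?_)
    (fun μ _ => aemeasurable_exitStopped hF n t μ) μ
  exact exitStopped_congr (F _).2.1.1 (F _).2.1.1 (fun s hs => apply_trunc_of_le hF hs ω) n

end Morphism

end TCSpace

/-! ### Optional sampling up to null sets -/

section OptionalSampling

theorem EventuallyMeasurableSet.mono {α : Type*} {m m' : MeasurableSpace α} (h : m ≤ m')
    {l : Filter α} [CountableInterFilter l] {s : Set α} (hs : EventuallyMeasurableSet m l s) :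
    EventuallyMeasurableSet m' l s := by
  obtain ⟨t, ht, hst⟩ := hs
  exact ⟨t, h _ ht, hst⟩

variable {Ω : Type*} [mΩ : MeasurableSpace Ω] {μ : Measure Ω}

theorem setIntegral_eq_of_condExp_eq [IsFiniteMeasure μ] {m : MeasurableSpace Ω} (hm : m ≤ mΩ)
    {f g : Ω → ℝ} (hf : Integrable f μ) (hfg : μ[f | m] =ᵐ[μ] g) {A : Set Ω}
    (hA : EventuallyMeasurableSet m (ae μ) A) : ∫ ω in A, f ω ∂μ = ∫ ω in A, g ω ∂μ := by
  obtain ⟨B, hB, hAB⟩ := hA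
  rw [setIntegral_congr_set hAB, setIntegral_congr_set hAB, ← setIntegral_condExp hm hf hB]
  exact setIntegral_congr_ae (hm _ hB) (hfg.mono fun ω hω _ => hω)

theorem tendsto_apply_of_rightContinuous {Ω 𝕋 : Type*} [LinearOrder 𝕋] [TopologicalSpace 𝕋]
    {Y : 𝕋 → Ω → ℝ} {θ : Ω → 𝕋}
    (hc : ∀ ω t, ContinuousWithinAt (Y · ω) (Set.Ici t) t) {θ' : ℕ → Ω → 𝕋} {ω : Ω}
    (hle : ∀ k, θ ω ≤ θ' k ω) (hlim : Tendsto (fun k => θ' k ω) atTop (𝓝 (θ ω))) :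
    Tendsto (fun k => Y (θ' k ω) ω) atTop (𝓝 (Y (θ ω) ω)) :=
  (hc ω (θ ω)).tendsto.comp (tendsto_nhdsWithin_iff.2 ⟨hlim, Eventually.of_forall hle⟩)

section Countable

variable {𝕋 : Type*} [LinearOrder 𝕋] {𝓕 : Filtration 𝕋 mΩ} {Y : 𝕋 → Ω → ℝ} {θ : Ω → 𝕋}

theorem eventuallyMeasurableSet_eq_of_countable (hθc : (Set.range θ).Countable)
    (hθ : ∀ u, EventuallyMeasurableSet (𝓕 u) (ae μ) {ω | θ ω ≤ u}) (u : 𝕋) :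
    EventuallyMeasurableSet (𝓕 u) (ae μ) {ω | θ ω = u} := by
  have h : {ω | θ ω = u} = {ω | θ ω ≤ u} \ ⋃ v ∈ Set.range θ ∩ Set.Iio u, {ω | θ ω ≤ v} := by
    ext ω
    simp only [Set.mem_ofPred_eq, Set.mem_sdiff, Set.mem_iUnion, not_exists, not_le]
    constructor
    · rintro rfl
      exact ⟨le_rfl, fun v hv => hv.2⟩
    · rintro ⟨h1, h2⟩
      by_contra hne
      exact lt_irrefl _ (h2 (θ ω) ⟨⟨ω, rfl⟩, lt_of_le_of_ne h1 hne⟩)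
  rw [h]
  exact MeasurableSet.diff (hθ u) (MeasurableSet.biUnion (hθc.mono Set.inter_subset_left)
    fun v hv => (hθ v).mono (𝓕.mono (le_of_lt hv.2)))

theorem aemeasurable_apply_of_countable (hY : ∀ t, AEMeasurable (Y t) μ)
    (hθc : (Set.range θ).Countable)
    (hθ : ∀ u, EventuallyMeasurableSet (𝓕 u) (ae μ) {ω | θ ω ≤ u}) :
    AEMeasurable (fun ω => Y (θ ω) ω) μ := by
  have := hθc.to_subtype
  have hU : ⋃ u : Set.range θ, {ω | θ ω = u} = Set.univ := by
    ext ω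
    simp
  rw [← Measure.restrict_univ (μ := μ), ← hU, aemeasurable_iUnion_iff]
  intro u
  have hn : NullMeasurableSet {ω | θ ω = u} μ :=
    (eventuallyMeasurableSet_eq_of_countable hθc hθ u).mono (𝓕.le u)
  refine (hY u).restrict.congr ?_
  filter_upwards [ae_restrict_mem₀ hn] with ω hω
  rw [show θ ω = u from hω]

/-- Optional stopping at a time with countably many values, on an event of the past of a time `s`
before it. -/
theorem setIntegral_apply_eq_of_countable [IsFiniteMeasure μ]
    (hY : ∀ t, AEMeasurable (Y t) μ) {M : ℝ} (hM : ∀ ω t, |Y t ω| ≤ M)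
    (hmart : ∀ s t, s ≤ t → μ[Y t | 𝓕 s] =ᵐ[μ] Y s)
    (hθc : (Set.range θ).Countable)
    (hθ : ∀ u, EventuallyMeasurableSet (𝓕 u) (ae μ) {ω | θ ω ≤ u})
    {s t : 𝕋} (ht : ∀ ω, θ ω ≤ t) {B : Set Ω} (hB : EventuallyMeasurableSet (𝓕 s) (ae μ) B)
    (hs : ∀ ω ∈ B, s ≤ θ ω) :
    ∫ ω in B, Y (θ ω) ω ∂μ = ∫ ω in B, Y t ω ∂μ := by
  have := hθc.to_subtype
  have hint : ∀ u, Integrable (Y u) μ := fun u =>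
    Integrable.of_bound (hY u).aestronglyMeasurable M (Eventually.of_forall fun ω => hM ω u)
  have hintθ : Integrable (fun ω => Y (θ ω) ω) μ :=
    Integrable.of_bound (aemeasurable_apply_of_countable hY hθc hθ).aestronglyMeasurable M
      (Eventually.of_forall fun ω => hM ω _)
  have hU : B = ⋃ u : Set.range θ, B ∩ {ω | θ ω = u} := by
    rw [← Set.inter_iUnion]
    ext ω
    simp
  have hBn : NullMeasurableSet B μ := hB.mono (𝓕.le s)
  have hn : ∀ u : Set.range θ, NullMeasurableSet (B ∩ {ω | θ ω = u}) μ := fun u =>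
    hBn.inter ((eventuallyMeasurableSet_eq_of_countable hθc hθ u).mono (𝓕.le u))
  have hd : Pairwise (Function.onFun (AEDisjoint μ) fun u : Set.range θ => B ∩ {ω | θ ω = u}) := by
    intro u v huv
    refine Disjoint.aedisjoint (Set.disjoint_left.2 fun ω h1 h2 => huv ?_)
    exact Subtype.ext (h1.2.symm.trans h2.2)
  rw [hU, integral_iUnion_ae hn hd hintθ.integrableOn,
    integral_iUnion_ae hn hd (hint t).integrableOn]
  refine tsum_congr fun u => ?_
  have h1 : ∫ ω in B ∩ {ω | θ ω = u}, Y (θ ω) ω ∂μ = ∫ ω in B ∩ {ω | θ ω = u}, Y u ω ∂μ := by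
    refine integral_congr_ae ?_
    filter_upwards [ae_restrict_mem₀ (hn u)] with ω hω
    rw [show θ ω = u from hω.2]
  rw [h1]
  by_cases hsu : s ≤ u
  · obtain ⟨u, ω, rfl⟩ := u
    refine (setIntegral_eq_of_condExp_eq (𝓕.le _) (hint t) (hmart _ t (ht ω)) ?_).symm
    exact MeasurableSet.inter (hB.mono (𝓕.mono hsu))
      (eventuallyMeasurableSet_eq_of_countable hθc hθ _)
  · have he : B ∩ {ω | θ ω = u} = ∅ := by
      ext ω
      simp only [Set.mem_inter_iff, Set.mem_ofPred_eq, Set.mem_empty_iff_false, iff_false, not_and]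
      exact fun hω h => hsu (h ▸ hs ω hω)
    rw [he]
    simp

end Countable

variable {𝕋 : Type} [CommSemiring 𝕋] [LinearOrder 𝕋] [InfSet 𝕋] [Sub 𝕋]
  [TopologicalSpace 𝕋] [MeasurableSpace 𝕋] [h𝕋 : IsTimeSet 𝕋]
  {𝓕 : Filtration 𝕋 mΩ} {Y : 𝕋 → Ω → ℝ} {θ : Ω → 𝕋}

/-- A stopping time up to null sets, capped at `t`, is a decreasing limit of such times with
countably many values. -/
theorem exists_seq_countable_stopping
    (hθ : ∀ u, EventuallyMeasurableSet (𝓕 u) (ae μ) {ω | θ ω ≤ u}) (t : 𝕋) :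
    ∃ θ' : ℕ → Ω → 𝕋, (∀ k, (Set.range (θ' k)).Countable) ∧
      (∀ k u, EventuallyMeasurableSet (𝓕 u) (ae μ) {ω | θ' k ω ≤ u}) ∧
      (∀ k ω, min (θ ω) t ≤ θ' k ω) ∧ (∀ k ω, θ' k ω ≤ t) ∧
      ∀ ω, Tendsto (fun k => θ' k ω) atTop (𝓝 (min (θ ω) t)) := by
  obtain ⟨d, e, hd, hde, hle, hel, hlim⟩ := IsTimeSet.exists_rounding (𝕋 := 𝕋)
  refine ⟨fun k ω => min (d k (θ ω)) t, fun k => ?_, fun k u => ?_,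
    fun k ω => min_le_min_right _ (hle _ _), fun k ω => min_le_right _ _,
    fun ω => (hlim _).min tendsto_const_nhds⟩
  · refine ((hd k).image fun r => min r t).mono ?_
    rintro _ ⟨ω, rfl⟩
    exact ⟨d k (θ ω), ⟨_, rfl⟩, rfl⟩
  · simp only [min_le_iff, hde]
    exact MeasurableSet.union ((hθ (e k u)).mono (𝓕.mono (hel k u))) (MeasurableSet.const _)

theorem aemeasurable_apply_min (hY : ∀ t, AEMeasurable (Y t) μ)
    (hc : ∀ ω t, ContinuousWithinAt (Y · ω) (Set.Ici t) t)
    (hθ : ∀ u, EventuallyMeasurableSet (𝓕 u) (ae μ) {ω | θ ω ≤ u}) (t : 𝕋) :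
    AEMeasurable (fun ω => Y (min (θ ω) t) ω) μ := by
  obtain ⟨θ', hc', hst, hle, -, hlim⟩ := exists_seq_countable_stopping hθ t
  exact aemeasurable_of_tendsto_metrizable_ae atTop
    (fun k => aemeasurable_apply_of_countable hY (hc' k) (hst k))
    (Eventually.of_forall fun ω => tendsto_apply_of_rightContinuous
      (θ := fun ω => min (θ ω) t) hc (fun k => hle k ω) (hlim ω))

theorem integrable_apply_min [IsFiniteMeasure μ] (hY : ∀ t, AEMeasurable (Y t) μ)
    (hc : ∀ ω t, ContinuousWithinAt (Y · ω) (Set.Ici t) t) {M : ℝ} (hM : ∀ ω t, |Y t ω| ≤ M)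
    (hθ : ∀ u, EventuallyMeasurableSet (𝓕 u) (ae μ) {ω | θ ω ≤ u}) (t : 𝕋) :
    Integrable (fun ω => Y (min (θ ω) t) ω) μ :=
  Integrable.of_bound (aemeasurable_apply_min hY hc hθ t).aestronglyMeasurable M
    (Eventually.of_forall fun ω => hM ω _)

/-- Optional stopping for a bounded right-continuous martingale, where adaptedness of the process
and measurability of the stopping time hold up to null sets only. -/
theorem setIntegral_apply_min_eq [IsFiniteMeasure μ] (hY : ∀ t, AEMeasurable (Y t) μ)
    (hc : ∀ ω t, ContinuousWithinAt (Y · ω) (Set.Ici t) t) {M : ℝ} (hM : ∀ ω t, |Y t ω| ≤ M)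
    (hmart : ∀ s t, s ≤ t → μ[Y t | 𝓕 s] =ᵐ[μ] Y s)
    (hθ : ∀ u, EventuallyMeasurableSet (𝓕 u) (ae μ) {ω | θ ω ≤ u})
    {s t : 𝕋} (hst : s ≤ t) {A : Set Ω} (hA : EventuallyMeasurableSet (𝓕 s) (ae μ) A) :
    ∫ ω in A, (Y (min (θ ω) t) ω - Y (min (θ ω) s) ω) ∂μ = 0 := by
  have hint : ∀ u, Integrable (Y u) μ := fun u =>
    Integrable.of_bound (hY u).aestronglyMeasurable M (Eventually.of_forall fun ω => hM ω u)
  set B : Set Ω := A ∩ {ω | θ ω ≤ s}ᶜ with hBdef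
  have hB : EventuallyMeasurableSet (𝓕 s) (ae μ) B :=
    MeasurableSet.inter hA (MeasurableSet.compl (hθ s))
  have hAn : NullMeasurableSet A μ := hA.mono (𝓕.le s)
  have hBn : NullMeasurableSet B μ := hB.mono (𝓕.le s)
  -- On `{θ ≤ s}` the increment vanishes, so only `B` matters.
  have h0 : ∫ ω in A, (Y (min (θ ω) t) ω - Y (min (θ ω) s) ω) ∂μ =
      ∫ ω in B, (Y (min (θ ω) t) ω - Y (min (θ ω) s) ω) ∂μ := by
    refine setIntegral_eq_of_subset_of_ae_sdiff_eq_zero hAn Set.inter_subset_left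
      (Eventually.of_forall fun ω hω => ?_)
    have hle : θ ω ≤ s := by
      by_contra h
      exact hω.2 ⟨hω.1, h⟩
    rw [min_eq_left hle, min_eq_left (hle.trans hst), sub_self]
  have h1 : ∫ ω in B, Y (min (θ ω) t) ω ∂μ = ∫ ω in B, Y t ω ∂μ := by
    obtain ⟨θ', hc', hst', hle, hlet, hlim⟩ := exists_seq_countable_stopping hθ t
    have hk : ∀ k, ∫ ω in B, Y (θ' k ω) ω ∂μ = ∫ ω in B, Y t ω ∂μ := fun k =>
      setIntegral_apply_eq_of_countable hY hM hmart (hc' k) (hst' k) (hlet k) hB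
        fun ω hω => (le_min (le_of_lt (not_le.1 hω.2)) hst).trans (hle k ω)
    have hl : Tendsto (fun k => ∫ ω in B, Y (θ' k ω) ω ∂μ) atTop
        (𝓝 (∫ ω in B, Y (min (θ ω) t) ω ∂μ)) :=
      tendsto_integral_of_dominated_convergence (fun _ => M)
        (fun k => (aemeasurable_apply_of_countable hY (hc' k)
          (hst' k)).restrict.aestronglyMeasurable)
        (integrable_const M) (fun k => Eventually.of_forall fun ω => hM ω _)
        (Eventually.of_forall fun ω => tendsto_apply_of_rightContinuous
          (θ := fun ω => min (θ ω) t) hc (fun k => hle k ω) (hlim ω))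
    simp_rw [hk] at hl
    exact (tendsto_const_nhds_iff.1 hl).symm
  have h2 : ∫ ω in B, Y (min (θ ω) s) ω ∂μ = ∫ ω in B, Y s ω ∂μ := by
    refine integral_congr_ae ?_
    filter_upwards [ae_restrict_mem₀ hBn] with ω hω
    rw [min_eq_right (le_of_lt (not_le.1 hω.2))]
  rw [h0, integral_sub (integrable_apply_min hY hc hM hθ t).integrableOn
    (integrable_apply_min hY hc hM hθ s).integrableOn, h1, h2,
    setIntegral_eq_of_condExp_eq (𝓕.le s) (hint t) (hmart s t hst) hB, sub_self]

end OptionalSampling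

namespace TCSpace

/-! ### Measurability of concatenation at a stopping time -/

theorem measurableSet_concat_mem {𝕋 Ω : Type*} [AddCommMonoid 𝕋] [LinearOrder 𝕋] [Sub 𝕋]
    [MeasurableSpace 𝕋] [MeasurableSpace Ω] (S : TCSpace 𝕋 Ω) {B : Set Ω} (hB : MeasurableSet B) :
    MeasurableSet {p : Ω × 𝕋 × Ω | p ∈ S.compat ∧ S.concat p.1 p.2.1 p.2.2 ∈ B} := by
  convert S.measurableSet_compat.subtype_image (S.measurable_concat hB) using 1
  ext p
  simp [and_comm]

section Concatenation

variable {𝕋 : Type} [CommSemiring 𝕋] [LinearOrder 𝕋] [InfSet 𝕋] [Sub 𝕋]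
  [TopologicalSpace 𝕋] [MeasurableSpace 𝕋] [h𝕋 : IsTimeSet 𝕋] {Ω : Type*} [mΩ : MeasurableSpace Ω]
  {S : TCSpace 𝕋 Ω} {τ : Ω → WithTop 𝕋}

theorem measurableSet_eq_top (hτ : IsStoppingTime S.filtration τ) :
    MeasurableSet {ω | τ ω = ⊤} := by
  have h : {ω | τ ω = ⊤} = (⋃ n : ℕ, {ω | τ ω ≤ ((n : 𝕋) : WithTop 𝕋)})ᶜ := by
    ext ω
    simp only [Set.mem_ofPred_eq, Set.mem_compl_iff, Set.mem_iUnion, not_exists]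
    induction hω : τ ω with
    | top => simp
    | coe r =>
      obtain ⟨n, hn⟩ := IsTimeSet.exists_le_natCast r
      simp only [WithTop.coe_ne_top, false_iff, not_forall, not_not]
      exact ⟨n, WithTop.coe_le_coe.2 hn⟩
  rw [h]
  exact (MeasurableSet.iUnion fun n : ℕ => S.filtration.le _ _ (hτ (n : 𝕋))).compl

theorem measurable_untopD (hτ : IsStoppingTime S.filtration τ) :
    Measurable fun ω => (τ ω).untopD 0 := by
  refine measurable_of_Iic fun u => ?_
  have h : (fun ω => (τ ω).untopD 0) ⁻¹' Set.Iic u = {ω | τ ω = ⊤} ∪ {ω | τ ω ≤ u} := by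
    ext ω
    simp only [Set.mem_preimage, Set.mem_Iic, Set.mem_union, Set.mem_ofPred_eq]
    induction τ ω with
    | top => simp
    | coe r => simp
  rw [h]
  exact (measurableSet_eq_top hτ).union (S.filtration.le _ _ (hτ u))

theorem measurable_truncTop (hτ : IsStoppingTime S.filtration τ) :
    Measurable fun ω => S.truncTop (τ ω) ω := by
  classical
  have h : (fun ω => S.truncTop (τ ω) ω) =
      fun ω => if τ ω = ⊤ then ω else S.trunc ((τ ω).untopD 0) ω := by
    ext ω
    induction τ ω with
    | top => rfl
    | coe r => rfl
  rw [h]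
  exact Measurable.ite (measurableSet_eq_top hτ) measurable_id
    (S.measurable_trunc.comp ((measurable_untopD hτ).prodMk measurable_id))

theorem measurableSet_concatTop_mem (hτ : IsStoppingTime S.filtration τ) {B : Set Ω}
    (hB : MeasurableSet B) :
    MeasurableSet {p : Ω × Ω | p.2 ∈ S.compatTop p.1 (τ p.1) ∧
      S.concatTop p.1 (τ p.1) p.2 ∈ B} := by
  have h : {p : Ω × Ω | p.2 ∈ S.compatTop p.1 (τ p.1) ∧ S.concatTop p.1 (τ p.1) p.2 ∈ B} =
      {p | τ p.1 = ⊤ ∧ p.1 ∈ B} ∪ {p | τ p.1 ≠ ⊤ ∧ (p.1, (τ p.1).untopD 0, p.2) ∈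
        {p : Ω × 𝕋 × Ω | p ∈ S.compat ∧ S.concat p.1 p.2.1 p.2.2 ∈ B}} := by
    ext ⟨ω, ω'⟩
    simp only [Set.mem_ofPred_eq, Set.mem_union]
    induction τ ω with
    | top => simp [TCOps.compatTop, TCOps.concatTop]
    | coe r => simp [TCOps.compatTop, TCOps.concatTop]
  have htop : MeasurableSet {p : Ω × Ω | τ p.1 = ⊤} := measurable_fst (measurableSet_eq_top hτ)
  rw [h]
  refine (htop.inter (measurable_fst hB)).union (htop.compl.inter ?_)
  exact (measurable_fst.prodMk (((measurable_untopD hτ).comp measurable_fst).prodMk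
    measurable_snd)) (S.measurableSet_concat_mem hB)

theorem measurableSet_compatTop (hτ : IsStoppingTime S.filtration τ) :
    MeasurableSet {p : Ω × Ω | p.2 ∈ S.compatTop p.1 (τ p.1)} := by
  simpa using measurableSet_concatTop_mem hτ MeasurableSet.univ

/-- Concatenation is measurable on compatible pairs only; elsewhere its values are arbitrary. -/
theorem aemeasurable_concatTop (hτ : IsStoppingTime S.filtration τ) {Q : Measure (Ω × Ω)}
    (hQ : ∀ᵐ p ∂Q, p.2 ∈ S.compatTop p.1 (τ p.1)) :
    AEMeasurable (fun p : Ω × Ω => S.concatTop p.1 (τ p.1) p.2) Q := by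
  classical
  refine ⟨fun p => if p.2 ∈ S.compatTop p.1 (τ p.1) then S.concatTop p.1 (τ p.1) p.2 else p.1,
    fun B hB => ?_, ?_⟩
  · have h : (fun p : Ω × Ω => if p.2 ∈ S.compatTop p.1 (τ p.1)
          then S.concatTop p.1 (τ p.1) p.2 else p.1) ⁻¹' B =
        {p | p.2 ∈ S.compatTop p.1 (τ p.1) ∧ S.concatTop p.1 (τ p.1) p.2 ∈ B} ∪
          ({p | p.2 ∈ S.compatTop p.1 (τ p.1)}ᶜ ∩ Prod.fst ⁻¹' B) := by
      ext p
      by_cases hp : p.2 ∈ S.compatTop p.1 (τ p.1) <;> simp [hp]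
    rw [h]
    exact (measurableSet_concatTop_mem hτ hB).union
      ((measurableSet_compatTop hτ).compl.inter (measurable_fst hB))
  · filter_upwards [hQ] with p hp
    rw [if_pos hp]

end Concatenation

theorem measureConcat_eq_map_compProd {𝕋 : Type} [CommSemiring 𝕋] [LinearOrder 𝕋] [Sub 𝕋]
    [MeasurableSpace 𝕋] {Ω : Type*} [MeasurableSpace Ω] {S : TCSpace 𝕋 Ω} {τ : Ω → WithTop 𝕋}
    {μ : Measure Ω} [IsProbabilityMeasure μ]
    {ν : Ω → Measure Ω} {κ : Kernel Ω Ω} [IsMarkovKernel κ]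
    (hκ : ∀ᵐ ω ∂μ, κ ω = ν (S.truncTop (τ ω) ω)) :
    S.measureConcat τ μ ν = (μ ⊗ₘ κ).map fun p => S.concatTop p.1 (τ p.1) p.2 := by
  have hm : Measurable fun ω => (κ ω).map (Prod.mk ω) := by
    refine Measure.measurable_of_measurable_coe _ fun B hB => ?_
    simp_rw [Measure.map_apply measurable_prodMk_left hB]
    exact Kernel.measurable_kernel_prodMk_left hB
  have h1 : (μ.bind fun ω => (S.restrictedKernel τ ν ω).map (Prod.mk ω)) =
      μ.bind fun ω => (κ ω).map (Prod.mk ω) := by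
    refine Measure.bind_congr_right ?_
    filter_upwards [hκ] with ω hω
    rw [hω]
    rfl
  have h2 : (μ.bind fun ω => (κ ω).map (Prod.mk ω)) = μ ⊗ₘ κ := by
    ext B hB
    rw [Measure.bind_apply hB hm.aemeasurable, Measure.compProd_apply hB]
    simp_rw [Measure.map_apply measurable_prodMk_left hB]
  rw [measureConcat, h1, h2]

/-! ### Martingale increments of the two parts of a concatenation -/

section Martingale

variable {𝕋 : Type} [CommSemiring 𝕋] [LinearOrder 𝕋] [InfSet 𝕋] [Sub 𝕋]
  [TopologicalSpace 𝕋] [MeasurableSpace 𝕋] [h𝕋 : IsTimeSet 𝕋] {Ω : Type*} [mΩ : MeasurableSpace Ω]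
  {S : TCSpace 𝕋 Ω} {F : Ω → CadlagZero 𝕋} {μ : Measure Ω}

theorem min_untopD_min {ι : Type*} [LinearOrder ι] [Zero ι] (x : WithTop ι) {s t : ι}
    (hst : s ≤ t) : min ((min x t).untopD 0) s = (min x s).untopD 0 := by
  induction x with
  | top => simp [hst]
  | coe r =>
    rw [← WithTop.coe_min, ← WithTop.coe_min, WithTop.untopD_coe, WithTop.untopD_coe, min_assoc,
      min_eq_right hst]

theorem untopD_min_le_iff {ι : Type*} [LinearOrder ι] [Zero ι] (x : WithTop ι) (t u : ι) :
    (min x t).untopD 0 ≤ u ↔ x ≤ u ∨ t ≤ u := by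
  induction x with
  | top => simp
  | coe r => rw [← WithTop.coe_min, WithTop.untopD_coe, min_le_iff, WithTop.coe_le_coe]

/-- The martingale property of `F^n` is preserved by a raw stopping time. -/
theorem setIntegral_exitStopped_stopping_eq_zero [IsFiniteMeasure μ]
    (hF : S.IsMorphism (cadlagZeroOps 𝕋) F) (hb : IsCanonicallyLocallyBounded F)
    (hμ : IsCanonicalLocalMartingale S.filtration F μ) {n : ℕ} (hn : 1 ≤ n)
    {τ : Ω → WithTop 𝕋} (hτ : IsStoppingTime S.filtration τ) {s t : 𝕋} (hst : s ≤ t) {A : Set Ω}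
    (hA : MeasurableSet[S.filtration s] A) :
    ∫ ω in A, (exitStopped n (F ω).1 ((min (τ ω) t).untopD 0) -
      exitStopped n (F ω).1 ((min (τ ω) s).untopD 0)) ∂μ = 0 := by
  obtain ⟨M, hM⟩ := hb
  have h := setIntegral_apply_min_eq (𝓕 := S.filtration) (μ := μ)
    (Y := fun t ω => exitStopped n (F ω).1 t) (θ := fun ω => (min (τ ω) t).untopD 0)
    (fun t => aemeasurable_exitStopped hF.nonAnticipating n t μ)
    (fun ω t => continuousWithinAt_exitStopped (F ω).2.1.1 n t) (hM n hn).2 (hμ n hn).2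
    (fun u => ?_) hst hA.eventuallyMeasurableSet
  · simpa only [min_untopD_min _ le_rfl, min_untopD_min _ hst] using h
  · have heq : {ω | (min (τ ω) t).untopD 0 ≤ u} = {ω | τ ω ≤ u} ∪ {_ω | t ≤ u} := by
      ext ω
      exact untopD_min_le_iff _ _ _
    rw [heq]
    exact ((hτ u).union (MeasurableSet.const _)).eventuallyMeasurableSet

theorem exitStopped_min_hitTime (y : CadlagZero 𝕋) (u : 𝕋) {a : ℝ} {n : ℕ} (ha : |a| ≤ n)
    {N : 𝕋} (hN : N ≤ n) : exitStopped (2 * n) y.1 (min (hitTime a n N y.1) u) =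
      y.1 (min (hitTime a n N y.1) u) := by
  rw [exitStopped, min_eq_right ((min_le_left _ _).trans (hitTime_le_exitTime y.2.1.1 ha hN))]

/-- Stopped when `|a + F|` reaches the level `n`, the process `F` is a martingale: it is `F^{2n}`
stopped at an earlier time. -/
theorem setIntegral_hitTime_eq_zero [IsFiniteMeasure μ]
    (hF : S.IsMorphism (cadlagZeroOps 𝕋) F) (hb : IsCanonicallyLocallyBounded F)
    (hμ : IsCanonicalLocalMartingale S.filtration F μ) {n : ℕ} (hn : 1 ≤ n) {a : ℝ} (ha : |a| ≤ n)
    {N : 𝕋} (hN : N ≤ n) {s t : 𝕋} (hst : s ≤ t) {A : Set Ω}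
    (hA : MeasurableSet[S.filtration s] A) :
    ∫ ω in A, ((F ω).1 (min (hitTime a n N (F ω).1) t) -
      (F ω).1 (min (hitTime a n N (F ω).1) s)) ∂μ = 0 := by
  obtain ⟨M, hM⟩ := hb
  have hn2 : 1 ≤ 2 * n := by omega
  have h := setIntegral_apply_min_eq (𝓕 := S.filtration) (μ := μ)
    (Y := fun t ω => exitStopped (2 * n) (F ω).1 t) (θ := fun ω => hitTime a n N (F ω).1)
    (fun t => aemeasurable_exitStopped hF.nonAnticipating _ t μ)
    (fun ω t => continuousWithinAt_exitStopped (F ω).2.1.1 _ t) (hM _ hn2).2 (hμ _ hn2).2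
    (fun u => eventuallyMeasurableSet_hitTime_le hF.nonAnticipating a n N u μ) hst
    hA.eventuallyMeasurableSet
  simpa only [exitStopped_min_hitTime _ _ ha hN] using h

theorem integrable_hitTime [IsFiniteMeasure μ]
    (hF : S.IsMorphism (cadlagZeroOps 𝕋) F) (hb : IsCanonicallyLocallyBounded F)
    {n : ℕ} (hn : 1 ≤ n) {a : ℝ} (ha : |a| ≤ n) {N : 𝕋} (hN : N ≤ n) (t : 𝕋) :
    Integrable (fun ω => (F ω).1 (min (hitTime a n N (F ω).1) t)) μ := by
  obtain ⟨M, hM⟩ := hb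
  have h := integrable_apply_min (𝓕 := S.filtration) (μ := μ)
    (Y := fun t ω => exitStopped (2 * n) (F ω).1 t) (θ := fun ω => hitTime a n N (F ω).1)
    (fun t => aemeasurable_exitStopped hF.nonAnticipating _ t μ)
    (fun ω t => continuousWithinAt_exitStopped (F ω).2.1.1 _ t)
    (hM (2 * n) (by omega)).2
    (fun u => eventuallyMeasurableSet_hitTime_le hF.nonAnticipating a n N u μ) t
  simpa only [exitStopped_min_hitTime _ _ ha hN] using h

/-- The stopped process of a morphism along a concatenation. -/
theorem exitStopped_apply_concat (hF : S.IsMorphism (cadlagZeroOps 𝕋) F) {ω ω' : Ω} {r : 𝕋}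
    (h : (ω, r, ω') ∈ S.compat) (n : ℕ) (t : 𝕋) :
    exitStopped n (F (S.concat ω r ω')).1 t = exitStopped n (F ω).1 (min t r) +
      if r < exitTime n (F ω).1 then
        (F ω').1 (min (hitTime ((F ω).1 r) n (n - r) (F ω').1) (t - r)) else 0 := by
  have hval : ∀ s, (F (S.concat ω r ω')).1 s =
      if s ≤ r then (F ω).1 s else (F ω).1 r + (F ω').1 (s - r) - (F ω').1 0 := fun s => by
    rw [hF.map_concat ω r ω' h]
    rfl
  refine exitStopped_concat (F ω).2.1.1 (F ω').2.1.1 (F ω').2.2 (F _).2.1.1 (fun s hs => ?_)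
    (fun s hs => ?_) n t
  · rw [hval, if_pos hs]
  · rw [hval]
    split_ifs with hsr
    · rw [le_antisymm hsr hs, tsub_self, (F ω').2.2, add_zero]
    · rw [(F ω').2.2, sub_zero]

/-- Integrating out the second path: past the time `r` of concatenation, a martingale increment has
mean zero under a measure for which `F` is a canonical local martingale. -/
theorem integral_indicator_increment_concat [IsProbabilityMeasure μ]
    (hF : S.IsMorphism (cadlagZeroOps 𝕋) F) (hb : IsCanonicallyLocallyBounded F)
    (hμ : IsCanonicalLocalMartingale S.filtration F μ) {n : ℕ} (hn : 1 ≤ n) {ω : Ω} {r : 𝕋}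
    (hc : ∀ᵐ ω' ∂μ, (ω, r, ω') ∈ S.compat) {s t : 𝕋} (hst : s ≤ t) {A : Set Ω}
    (hA : MeasurableSet[S.filtration s] A) :
    ∫ ω', A.indicator (fun η => exitStopped n (F η).1 t - exitStopped n (F η).1 s)
        (S.concat ω r ω') ∂μ =
      A.indicator (fun η => exitStopped n (F η).1 (min t r) - exitStopped n (F η).1 (min s r))
        ω := by
  set Z : 𝕋 → Ω → ℝ := fun u ω' => if r < exitTime n (F ω).1 then
    (F ω').1 (min (hitTime ((F ω).1 r) n (n - r) (F ω').1) u) else 0 with hZ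
  have hZint : ∀ A' : Set Ω, MeasurableSet[S.filtration (s - r)] A' →
      ∫ ω' in A', (Z (t - r) ω' - Z (s - r) ω') ∂μ = 0 := by
    intro A' hA'
    simp only [hZ]
    split_ifs with hr
    · rw [← not_le, exitTime_le_iff (F ω).2.1.1] at hr
      push Not at hr
      exact setIntegral_hitTime_eq_zero hF hb hμ hn (hr.1 r le_rfl).le tsub_le_self
        (tsub_le_tsub_right hst r) hA'
    · simp
  have hZi : ∀ u, Integrable (Z u) μ := by
    intro u
    simp only [hZ]
    split_ifs with hr
    · rw [← not_le, exitTime_le_iff (F ω).2.1.1] at hr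
      push Not at hr
      exact integrable_hitTime hF hb hn (hr.1 r le_rfl).le tsub_le_self u
    · exact integrable_const _
  rw [S.filtration_eq] at hA
  obtain ⟨B, hB, rfl⟩ := hA
  rcases le_or_gt s r with hsr | hrs
  · -- The event is decided by the first path, and the second path starts at zero.
    have hind : ∀ᵐ ω' ∂μ, (S.trunc s ⁻¹' B).indicator
        (fun η => exitStopped n (F η).1 t - exitStopped n (F η).1 s) (S.concat ω r ω') =
        (S.trunc s ⁻¹' B).indicator (fun η => exitStopped n (F η).1 (min t r) -
          exitStopped n (F η).1 (min s r)) ω +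
        (S.trunc s ⁻¹' B).indicator 1 ω * (Z (t - r) ω' - Z (s - r) ω') := by
      filter_upwards [hc] with ω' hω'
      have hmem : S.concat ω r ω' ∈ S.trunc s ⁻¹' B ↔ ω ∈ S.trunc s ⁻¹' B := by
        rw [Set.mem_preimage, Set.mem_preimage, S.trunc_concat_of_le ω r ω' s hω' hsr]
      by_cases hω : ω ∈ S.trunc s ⁻¹' B
      · rw [Set.indicator_of_mem (hmem.2 hω), Set.indicator_of_mem hω, Set.indicator_of_mem hω,
          exitStopped_apply_concat hF hω', exitStopped_apply_concat hF hω']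
        simp only [hZ, Pi.one_apply]
        ring
      · rw [Set.indicator_of_notMem (mt hmem.1 hω), Set.indicator_of_notMem hω,
          Set.indicator_of_notMem hω]
        ring
    have hZ0 := hZint Set.univ MeasurableSet.univ
    rw [setIntegral_univ] at hZ0
    have hD : Integrable (fun ω' => Z (t - r) ω' - Z (s - r) ω') μ := (hZi _).sub (hZi _)
    rw [integral_congr_ae hind, integral_add (integrable_const _) (hD.const_mul _),
      integral_const_mul, hZ0]
    simp
  · -- The event, read as an event for the second path, belongs to the past up to time `s - r`.
    set A' : Set Ω := S.trunc (s - r) ⁻¹' {ω' | (ω, r, ω') ∈ S.compat ∧ S.concat ω r ω' ∈ B}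
      with hA'
    have hA'm : MeasurableSet[S.filtration (s - r)] A' := by
      rw [S.filtration_eq]
      exact ⟨_, (measurable_const.prodMk (measurable_const.prodMk measurable_id))
        (S.measurableSet_concat_mem hB), rfl⟩
    have hind : ∀ᵐ ω' ∂μ, (S.trunc s ⁻¹' B).indicator
        (fun η => exitStopped n (F η).1 t - exitStopped n (F η).1 s) (S.concat ω r ω') =
        A'.indicator (fun ω' => Z (t - r) ω' - Z (s - r) ω') ω' := by
      filter_upwards [hc] with ω' hω'
      have hmem : S.concat ω r ω' ∈ S.trunc s ⁻¹' B ↔ ω' ∈ A' := by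
        rw [Set.mem_preimage, S.trunc_concat_of_lt ω r ω' s hω' hrs]
        exact ⟨fun h => ⟨(S.compat_trunc_right ω r ω' (s - r)).1 hω', h⟩, fun h => h.2⟩
      by_cases hω : ω' ∈ A'
      · rw [Set.indicator_of_mem (hmem.2 hω), Set.indicator_of_mem hω,
          exitStopped_apply_concat hF hω', exitStopped_apply_concat hF hω',
          min_eq_right hrs.le, min_eq_right (hrs.le.trans hst)]
        simp only [hZ]
        ring
      · rw [Set.indicator_of_notMem (mt hmem.1 hω), Set.indicator_of_notMem hω]
    rw [integral_congr_ae hind, integral_indicator (S.filtration.le _ _ hA'm), hZint A' hA'm,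
      min_eq_right hrs.le, min_eq_right (hrs.le.trans hst)]
    simp

theorem integral_indicator_increment_concatTop [IsProbabilityMeasure μ]
    (hF : S.IsMorphism (cadlagZeroOps 𝕋) F) (hb : IsCanonicallyLocallyBounded F)
    (hμ : IsCanonicalLocalMartingale S.filtration F μ) {n : ℕ} (hn : 1 ≤ n) {ω : Ω}
    {u : WithTop 𝕋} (hc : ∀ᵐ ω' ∂μ, ω' ∈ S.compatTop ω u) {s t : 𝕋} (hst : s ≤ t) {A : Set Ω}
    (hA : MeasurableSet[S.filtration s] A) :
    ∫ ω', A.indicator (fun η => exitStopped n (F η).1 t - exitStopped n (F η).1 s)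
        (S.concatTop ω u ω') ∂μ =
      A.indicator (fun η => exitStopped n (F η).1 ((min u t).untopD 0) -
        exitStopped n (F η).1 ((min u s).untopD 0)) ω := by
  induction u with
  | top =>
    have h : ∀ ω', S.concatTop ω ⊤ ω' = ω := fun _ => rfl
    simp [h]
  | coe r =>
    rw [← WithTop.coe_min, ← WithTop.coe_min, WithTop.untopD_coe, WithTop.untopD_coe, min_comm r,
      min_comm r]
    exact integral_indicator_increment_concat hF hb hμ hn hc hst hA

end Martingale

end TCSpace

/-! ### Concatenation within a generated correspondence -/

namespace TCSpace

section Generated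

variable {𝕋 : Type} [CommSemiring 𝕋] [LinearOrder 𝕋] [InfSet 𝕋] [Sub 𝕋]
  [TopologicalSpace 𝕋] [MeasurableSpace 𝕋] [h𝕋 : IsTimeSet 𝕋] {Ω : Type*} [mΩ : MeasurableSpace Ω]
  {S : TCSpace 𝕋 Ω} {τ : Ω → WithTop 𝕋} {μ : Measure Ω} [IsProbabilityMeasure μ]

theorem ae_mem_compatTop {ν : Ω → Measure Ω} (hτ : IsStoppingTime S.filtration τ)
    (hc : S.MeasureCompatible τ μ ν) {κ : Kernel Ω Ω} [IsMarkovKernel κ]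
    (hκ : ∀ᵐ ω ∂μ, κ ω = ν (S.truncTop (τ ω) ω)) :
    ∀ᵐ p ∂(μ ⊗ₘ κ), p.2 ∈ S.compatTop p.1 (τ p.1) := by
  refine (Measure.ae_compProd_iff (measurableSet_compatTop hτ)).2 ?_
  filter_upwards [hc, hκ] with ω h1 h2
  have hm : MeasurableSet (S.compatTop ω (τ ω)) :=
    measurable_prodMk_left (x := ω) (measurableSet_compatTop hτ)
  refine (mem_ae_iff_prob_eq_one hm).2 ?_
  rw [h2]
  exact h1

/-- The canonical local martingale property is stable under concatenation with a kernel of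
canonical local-martingale measures. -/
theorem isCanonicalLocalMartingale_map_concatTop {F : Ω → CadlagZero 𝕋}
    (hF : S.IsMorphism (cadlagZeroOps 𝕋) F) (hb : IsCanonicallyLocallyBounded F)
    (hτ : IsStoppingTime S.filtration τ) {κ : Kernel Ω Ω} [IsMarkovKernel κ]
    (hc : ∀ᵐ p ∂(μ ⊗ₘ κ), p.2 ∈ S.compatTop p.1 (τ p.1))
    (hμ : IsCanonicalLocalMartingale S.filtration F μ)
    (hκ : ∀ᵐ ω ∂μ, IsCanonicalLocalMartingale S.filtration F (κ ω)) :
    IsCanonicalLocalMartingale S.filtration F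
      ((μ ⊗ₘ κ).map fun p => S.concatTop p.1 (τ p.1) p.2) := by
  have hcm := aemeasurable_concatTop hτ hc
  set P := (μ ⊗ₘ κ).map fun p => S.concatTop p.1 (τ p.1) p.2 with hP
  have hPprob : IsProbabilityMeasure P := Measure.isProbabilityMeasure_map hcm
  obtain ⟨M, hM⟩ := id hb
  intro n hn
  have hint : ∀ t, Integrable (fun ω => exitStopped n (F ω).1 t) P := fun t =>
    Integrable.of_bound (aemeasurable_exitStopped hF.nonAnticipating n t P).aestronglyMeasurable
      (M n) (Eventually.of_forall fun ω => (hM n hn).2 ω t)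
  refine ⟨hint, fun s t hst => (ae_eq_condExp_of_forall_setIntegral_eq (S.filtration.le s) (hint t)
    (fun A _ _ => (hint s).integrableOn) (fun A hA _ => ?_)
    (aestronglyMeasurable_exitStopped hF.nonAnticipating n s P)).symm⟩
  have hAm : MeasurableSet A := S.filtration.le s _ hA
  set D : Ω → ℝ := A.indicator fun η => exitStopped n (F η).1 t - exitStopped n (F η).1 s with hD
  have hDint : Integrable D P := ((hint t).sub (hint s)).indicator hAm
  have hinner : ∀ᵐ ω ∂μ, ∫ ω', D (S.concatTop ω (τ ω) ω') ∂κ ω =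
      A.indicator (fun η => exitStopped n (F η).1 ((min (τ η) t).untopD 0) -
        exitStopped n (F η).1 ((min (τ η) s).untopD 0)) ω := by
    filter_upwards [hκ, Measure.ae_ae_of_ae_compProd hc] with ω hω hcω
    rw [hD, integral_indicator_increment_concatTop hF hb hω hn hcω hst hA]
    rfl
  have hDc : Integrable (fun p : Ω × Ω => D (S.concatTop p.1 (τ p.1) p.2)) (μ ⊗ₘ κ) :=
    (integrable_map_measure hDint.aestronglyMeasurable hcm).1 hDint
  have hzero : ∫ ω, D ω ∂P = 0 := by
    rw [hP, integral_map hcm hDint.aestronglyMeasurable, Measure.integral_compProd hDc,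
      integral_congr_ae hinner, integral_indicator hAm]
    exact setIntegral_exitStopped_stopping_eq_zero hF hb hμ hn hτ hst hA
  rw [hD, integral_indicator hAm, integral_sub (hint t).integrableOn (hint s).integrableOn,
    sub_eq_zero] at hzero
  exact hzero.symm

theorem trunc_zero_concatTop {ω ω' : Ω} {u : WithTop 𝕋} (h : ω' ∈ S.compatTop ω u) :
    S.trunc 0 (S.concatTop ω u ω') = S.trunc 0 ω := by
  induction u with
  | top => rfl
  | coe r => exact S.trunc_concat_of_le ω r ω' 0 h zero_le

theorem measureConcat_mem_generatedCorrespondence {E : Type*} [TopologicalSpace E]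
    [PolishSpace E] [MeasurableSpace E] [BorelSpace E] {X : Ω → E} (hX : Measurable X)
    {𝒟 : Set (Ω → CadlagZero 𝕋)}
    (h𝒟 : ∀ F ∈ 𝒟, S.IsMorphism (cadlagZeroOps 𝕋) F ∧ IsCanonicallyLocallyBounded F)
    {ω₀ : Ω} {μ : Measure Ω} (hμ : μ ∈ S.generatedCorrespondence 𝒟 X ω₀) {ν : Ω → Measure Ω}
    (hν : IsSelector (S.generatedCorrespondence 𝒟 X) ν) (hτ : IsStoppingTime S.filtration τ)
    (hc : S.MeasureCompatible τ μ ν) :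
    S.measureConcat τ μ ν ∈ S.generatedCorrespondence 𝒟 X ω₀ := by
  have := S.standardBorel
  have := hμ.1
  obtain ⟨κ, hκm, hκ⟩ := hν.1.exists_kernel_ae_eq μ (measurable_truncTop hτ)
  have hcomp := ae_mem_compatTop hτ hc hκ
  have hcm := aemeasurable_concatTop hτ hcomp
  rw [measureConcat_eq_map_compProd hκ]
  refine ⟨Measure.isProbabilityMeasure_map hcm, fun F hF => ?_, ?_⟩
  · refine isCanonicalLocalMartingale_map_concatTop (h𝒟 F hF).1 (h𝒟 F hF).2 hτ hcomp
      (hμ.2.1 F hF) ?_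
    filter_upwards [hκ] with ω hω
    rw [hω]
    exact (hν.2 _).2.1 F hF
  · have hm : MeasurableSet {ω | X (S.trunc 0 ω) = X ω₀} :=
      (hX.comp (S.measurable_trunc_apply 0)) (measurableSet_singleton _)
    rw [ae_map_iff hcm hm]
    filter_upwards [hcomp, Measure.ae_compProd_of_ae_fst κ hm hμ.2.2] with p hp1 hp2
    rw [trunc_zero_concatTop hp1]
    exact hp2

end Generated

/-- A measure chosen by a selector at `T_τ(ω)` starts from the state `X_τ(ω)`, which is all that
compatibility requires. -/
theorem measureCompatible_of_factorsThrough {𝕋 : Type} [CommSemiring 𝕋] [LinearOrder 𝕋]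
    [InfSet 𝕋] [Sub 𝕋] [TopologicalSpace 𝕋] [MeasurableSpace 𝕋] {Ω : Type*} [MeasurableSpace Ω]
    {S : TCSpace 𝕋 Ω} {E : Type*} {X : Ω → E}
    {𝒟 : Set (Ω → CadlagZero 𝕋)} (hS : S.FactorsThrough X) (μ : Measure Ω) {ν : Ω → Measure Ω}
    (hν : IsSelector (S.generatedCorrespondence 𝒟 X) ν) (τ : Ω → WithTop 𝕋) :
    S.MeasureCompatible τ μ ν := by
  refine Eventually.of_forall fun ω => ?_
  have hprob : ∀ u, IsProbabilityMeasure (ν (S.truncTop u ω)) := fun u => hν.1.1 _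
  rw [restrictedKernel]
  induction τ ω with
  | top => exact (hprob ⊤).measure_univ
  | coe r =>
    have := hprob r
    have hm : MeasurableSet {ω' | (ω, r, ω') ∈ S.compat} :=
      (measurable_const.prodMk (measurable_const.prodMk measurable_id)) S.measurableSet_compat
    refine (mem_ae_iff_prob_eq_one hm).1 ?_
    filter_upwards [(hν.2 (S.truncTop r ω)).2.2] with ω' hω'
    exact hS ω r ω' hω'.symm

end TCSpace

theorem mainTheorem7 {𝕋 : Type} [CommSemiring 𝕋] [LinearOrder 𝕋] [InfSet 𝕋] [Sub 𝕋]
    [TopologicalSpace 𝕋] [MeasurableSpace 𝕋] [IsTimeSet 𝕋]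
    {Ω : Type*} [MeasurableSpace Ω] (S : TCSpace 𝕋 Ω)
    {E : Type*} [TopologicalSpace E] [PolishSpace E] [MeasurableSpace E] [BorelSpace E]
    (X : Ω → E) (hX : Measurable X)
    (𝒟 : Set (Ω → CadlagZero 𝕋))
    (h𝒟 : ∀ F ∈ 𝒟, S.IsMorphism (cadlagZeroOps 𝕋) F ∧ IsCanonicallyLocallyBounded F) :
    (∀ ω, ∀ μ ∈ S.generatedCorrespondence 𝒟 X ω,
      ∀ ν, IsSelector (S.generatedCorrespondence 𝒟 X) ν →
      ∀ τ, IsStoppingTime S.filtration τ → S.MeasureCompatible τ μ ν →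
        S.measureConcat τ μ ν ∈ S.generatedCorrespondence 𝒟 X ω) ∧
    (S.FactorsThrough X → S.IsConcatenable (S.generatedCorrespondence 𝒟 X)) := by
  refine ⟨fun ω μ hμ ν hν τ hτ hc =>
    TCSpace.measureConcat_mem_generatedCorrespondence hX h𝒟 hμ hν hτ hc,
    fun hS ω μ hμ ν hν τ hτ => ?_⟩
  have hc := TCSpace.measureCompatible_of_factorsThrough hS μ hν τ
  exact ⟨hc, TCSpace.measureConcat_mem_generatedCorrespondence hX h𝒟 hμ hν hτ hc⟩
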